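/- **Setting.** Let $d_x,d_y,d_h\ge 0$ be integers, $A\in\mathbb{R}^{d_h\times d_y}$ (no rank condition), $b\in\mathbb{R}^{d_h}$, $\mathcal{Y}=\{y\in\mathbb{R}^{d_y}: Ay-b\le 0\}$, and let $f,g:\mathbb{R}^{d_x}\times\mathbb{R}^{d_y}\to\mathbb{R}$ be continuously differentiable. Put $y^*(x)=z^*(x)=\arg\min_{y\in\mathcal{Y}}g(x,y)$, $\Phi(x)=f(x,y^*(x))$ and, for $\delta>0$, $y^*_\delta(x)=\arg\min_{y\in\mathcal{Y}}\{\delta f(x,y)+g(x,y)\}$ and $$\Phi_\delta(x)=\min_{y\in\mathcal{Y}}\max_{z\in\mathcal{Y}}\Big\{f(x,y)+\tfrac1\delta\big[g(x,y)-g(x,z)\big]\Big\}.$$ Assume: $\mathcal{Y}\neq\emptyset$ and $\Phi$ is bounded below; $f$ is $l_{f,0}$-Lipschitz on $\mathbb{R}^{d_x}\times\mathcal{Y}$; $\nabla f$ and $\nabla g$ are Lipschitz on $\mathbb{R}^{d_x}\times\mathbb{R}^{d_y}$ with constants $l_{f,1}$ and $l_{g,1}$; and $g(x,\cdot)$ is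 $\mu_g$-strongly convex on $\mathbb{R}^{d_y}$ for every $x$, with $\mu_g>0$. **Algorithm (SFLCB).** Write $y'=(y,\alpha)$, $z'=(z,\beta)$, $\mathcal{P}_y=\mathbb{R}^{d_y}\times\mathbb{R}^{d_h}_{-}$, $A'=(A,-I)$, and $$K(x,y',z',u,v)=\delta f(x,y)+g(x,y)-g(x,z)+u^\top(A'y'-b)-v^\top(A'z'-b)+\tfrac{\rho_1}{2}\|A'y'-b\|^2-\tfrac{\rho_2}{2}\|A'z'-b\|^2.$$ Starting from $x_0\in\mathbb{R}^{d_x}$, $y_0',z_0'\in\mathcal{P}_y$, $u_0,v_0\in\mathbb{R}^{d_h}$, iterate $$u_{t+1}=u_t+\eta_u(A'y_t'-b),\qquad v_{t+1}=v_t+\eta_v(A'z_t'-b),$$ $$x_{t+1}=x_t-\eta_x\nabla_xK,\qquad y'_{t+1}=\Pi_{\mathcal{P}_y}\big(y'_t-\eta_y\nabla_{y'}K\big),\qquad z'_{t+1}=\Pi_{\mathcal{P}_y}\big(z'_t+\eta_z\nabla_{z'}K\big),$$ with all gradients taken at $(x_t,y'_t,z'_t,u_{t+1},v_{t+1})$.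 Let $y'^*_\delta(x,u)=\arg\min_{y'\in\mathcal{P}_y}K$ and $z'^*(x,v)=\arg\max_{z'\in\mathcal{P}_y}K$. A point $\hat x$ is an $\epsilon$-stationary point of $\Phi_\delta$ if $\Phi_\delta$ is differentiable and $\|\nabla\Phi_\delta(\hat x)\|\le\epsilon$. **Theorem.** For all $\rho_1,\rho_2>0$ there are step sizes $\eta_x,\eta_y,\eta_z,\eta_u,\eta_v>0$, depending only on $d_x,d_y,d_h,A,\mu_g,l_{g,1},\rho_1,\rho_2$ (in particular not on $\epsilon$, $\delta$ or the initial point), such that for all $b,f,g,l_{f,0},l_{f,1}$ as above and all constants $0<c_1\le c_2$ the following hold. 1. For every initial point $(x_0,y_0',z_0',u_0,v_0)$ there is a constant $C$ such that, for all $\epsilon>0$ and all $\delta$ with $c_1\epsilon\le\delta\le c_2\epsilon$ and $2l_{f,1}\delta\le\mu_g$, some iterate $x_t$ with $t\le C\epsilon^{-4}$ is an $\epsilon$-stationary point of $\Phi_\delta$. 2. For every $x_0$ and every $\kappa$ there is a constant $C$ such that, for all such $\epsilon,\delta$ and all $y_0',z_0'\in\mathcal{P}_y$, $u_0,v_0\in\mathbb{R}^{d_h}$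 (which may vary with $\epsilon$ and $\delta$) satisfying $$\|y_0-y^*_\delta(x_0)\|\le\kappa\delta,\quad\|A'y'^*_\delta(x_0,u_0)-b\|\le\kappa\delta,\quad\|A'y_0'-b\|\le\kappa\delta,$$ $$\|z_0-z^*(x_0)\|\le\kappa\delta,\quad\|A'z'^*(x_0,v_0)-b\|\le\kappa\delta,\quad\|A'z_0'-b\|\le\kappa\delta,$$ some iterate $x_t$ with $t\le C\,(1+\|u_0\|+\|v_0\|)\,\epsilon^{-3}$ is an $\epsilon$-stationary point of $\Phi_\delta$. In particular the number of iterations is $O(\epsilon^{-3})$ when the initial multipliers stay bounded. -/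

import Mathlib

open scoped NNReal

/-- `ℝⁿ` with the Euclidean norm. -/
abbrev Vec (n : ℕ) : Type := EuclideanSpace ℝ (Fin n)

/-- `ℝᵐ × ℝⁿ` with the joint Euclidean norm `‖(p, q)‖² = ‖p‖² + ‖q‖²`. -/
abbrev VecPair (m n : ℕ) : Type := WithLp 2 (Vec m × Vec n)

/-- The point `(p, q)` of `ℝᵐ × ℝⁿ`. -/
abbrev vpair {m n : ℕ} (p : Vec m) (q : Vec n) : VecPair m n := WithLp.toLp 2 (p, q)

namespace SFLCB

noncomputable section

/-- A minimizer of `F` over `S` (meaningful when one exists; see `argminOn_spec`). -/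
def argminOn {E : Type*} [Nonempty E] (S : Set E) (F : E → ℝ) : E :=
  Classical.epsilon fun p => p ∈ S ∧ IsMinOn F S p

theorem argminOn_spec {E : Type*} [Nonempty E] {S : Set E} {F : E → ℝ}
    (h : ∃ p, p ∈ S ∧ IsMinOn F S p) :
    argminOn S F ∈ S ∧ IsMinOn F S (argminOn S F) :=
  Classical.epsilon_spec h

/-- `x̂` is an `ε`-stationary point of the differentiable function `F`. -/
def IsEpsStationary {n : ℕ} (ε : ℝ) (F : Vec n → ℝ) (x : Vec n) : Prop :=
  Differentiable ℝ F ∧ ‖gradient F x‖ ≤ ε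

variable {dx dy dh : ℕ}

/-! ### The bilevel problem and its penalty reformulation -/

/-- The lower-level feasible set `{y | A y - b ≤ 0}`. -/
def feasibleSet (A : Matrix (Fin dh) (Fin dy) ℝ) (b : Vec dh) : Set (Vec dy) :=
  {y | ∀ i, (Matrix.toEuclideanLin A y - b) i ≤ 0}

/-- `y*(x) = z*(x)`, the minimizer of `g(x, ·)` over the feasible set. -/
def zStar (g : VecPair dx dy → ℝ) (A : Matrix (Fin dh) (Fin dy) ℝ) (b : Vec dh)
    (x : Vec dx) : Vec dy :=
  argminOn (feasibleSet A b) fun y => g (vpair x y)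

/-- `y*_δ(x)`, the minimizer of `δ f(x, ·) + g(x, ·)` over the feasible set. -/
def yStar (f g : VecPair dx dy → ℝ) (A : Matrix (Fin dh) (Fin dy) ℝ) (b : Vec dh)
    (δ : ℝ) (x : Vec dx) : Vec dy :=
  argminOn (feasibleSet A b) fun y => δ * f (vpair x y) + g (vpair x y)

/-- The hyper-objective `Φ(x) = f(x, y*(x))`. -/
def hyperObj (f g : VecPair dx dy → ℝ) (A : Matrix (Fin dh) (Fin dy) ℝ) (b : Vec dh)
    (x : Vec dx) : ℝ :=
  f (vpair x (zStar g A b x))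

/-- The penalty reformulation
`Φ_δ(x) = min_{y ∈ 𝒴} max_{z ∈ 𝒴} f(x, y) + (g(x, y) - g(x, z)) / δ`. -/
def penaltyObj (f g : VecPair dx dy → ℝ) (A : Matrix (Fin dh) (Fin dy) ℝ) (b : Vec dh)
    (δ : ℝ) (x : Vec dx) : ℝ :=
  ⨅ y : feasibleSet A b, ⨆ z : feasibleSet A b,
    f (vpair x y.1) + 1 / δ * (g (vpair x y.1) - g (vpair x z.1))

/-- The standing assumptions on the problem data: `f`, `g` are continuously differentiable, the
feasible set is nonempty, `Φ` is bounded below, `f` is `lf0`-Lipschitz on `ℝ^dx × 𝒴`, `∇f` and `∇g`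
are Lipschitz with constants `lf1`, `lg1`, and every `g(x, ·)` is `μg`-strongly convex. -/
structure Assumptions (f g : VecPair dx dy → ℝ) (A : Matrix (Fin dh) (Fin dy) ℝ) (b : Vec dh)
    (lf0 lf1 lg1 : ℝ≥0) (μg : ℝ) : Prop where
  contDiff_f : ContDiff ℝ 1 f
  contDiff_g : ContDiff ℝ 1 g
  feasible_nonempty : (feasibleSet A b).Nonempty
  hyperObj_bddBelow : BddBelow (Set.range (hyperObj f g A b))
  lipschitz_f : LipschitzOnWith lf0 f {p | p.snd ∈ feasibleSet A b}
  lipschitz_grad_f : LipschitzWith lf1 (gradient f)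
  lipschitz_grad_g : LipschitzWith lg1 (gradient g)
  strongConvex_g : ∀ x, StrongConvexOn Set.univ μg fun y => g (vpair x y)

/-! ### The augmented Lagrangian -/

/-- `𝒫_y = ℝ^dy × ℝ^dh_-`, the domain of `y' = (y, α)` and `z' = (z, β)`. -/
def slackDomain (dy dh : ℕ) : Set (VecPair dy dh) :=
  {w | ∀ i, w.snd i ≤ 0}

/-- The projection onto `𝒫_y`: the nonpositive part of the slack is taken. -/
def projSlack (w : VecPair dy dh) : VecPair dy dh :=
  vpair w.fst (WithLp.toLp 2 fun i => min (w.snd i) 0)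

theorem projSlack_mem (w : VecPair dy dh) : projSlack w ∈ slackDomain dy dh := by
  intro i
  simp [projSlack]

/-- `projSlack w` is the point of `𝒫_y` nearest to `w`. -/
theorem projSlack_nearest (w p : VecPair dy dh) (hp : p ∈ slackDomain dy dh) :
    ‖w - projSlack w‖ ≤ ‖w - p‖ := by
  rw [WithLp.prod_norm_eq_of_L2, WithLp.prod_norm_eq_of_L2]
  apply Real.sqrt_le_sqrt
  have h1 : ‖(w - projSlack w).fst‖ = 0 := by simp [projSlack]
  have h2 : ‖(w - projSlack w).snd‖ ≤ ‖(w - p).snd‖ := by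
    rw [EuclideanSpace.norm_eq, EuclideanSpace.norm_eq]
    apply Real.sqrt_le_sqrt
    apply Finset.sum_le_sum
    intro i _
    have hpi : p.snd i ≤ 0 := hp i
    have e1 : (w - projSlack w).snd i = w.snd i - min (w.snd i) 0 := by simp [projSlack]
    have e2 : (w - p).snd i = w.snd i - p.snd i := by simp
    rw [e1, e2, Real.norm_eq_abs, Real.norm_eq_abs]
    apply pow_le_pow_left₀ (abs_nonneg _)
    rcases le_total (w.snd i) 0 with h | h
    · simp [min_eq_left h]
    · rw [min_eq_right h, abs_of_nonneg (by linarith), abs_of_nonneg (by linarith)]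
      linarith
  have h3 := norm_nonneg (w - projSlack w).snd
  rw [h1]
  nlinarith [sq_nonneg ‖(w - p).fst‖]

/-- The residual `A' y' - b = A y - α - b` of `y' = (y, α)`, with `A' = (A, -I)`. -/
def residual (A : Matrix (Fin dh) (Fin dy) ℝ) (b : Vec dh) (w : VecPair dy dh) : Vec dh :=
  Matrix.toEuclideanLin A w.fst - w.snd - b

/-- The augmented Lagrangian
`K = δ f(x,y) + g(x,y) - g(x,z) + uᵀ(A'y'-b) - vᵀ(A'z'-b) + ρ₁/2 ‖A'y'-b‖² - ρ₂/2 ‖A'z'-b‖²`. -/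
def augLag (f g : VecPair dx dy → ℝ) (A : Matrix (Fin dh) (Fin dy) ℝ) (b : Vec dh)
    (δ ρ₁ ρ₂ : ℝ) (x : Vec dx) (y' z' : VecPair dy dh) (u v : Vec dh) : ℝ :=
  δ * f (vpair x y'.fst) + g (vpair x y'.fst) - g (vpair x z'.fst)
    + inner ℝ u (residual A b y') - inner ℝ v (residual A b z')
    + ρ₁ / 2 * ‖residual A b y'‖ ^ 2 - ρ₂ / 2 * ‖residual A b z'‖ ^ 2

/-- `y'*_δ(x, u)`, the minimizer of `K(x, ·, z', u, v)` over `𝒫_y`. The arguments `z'`, `v` only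
contribute an additive constant and are set to `0`. -/
def yAugStar (f g : VecPair dx dy → ℝ) (A : Matrix (Fin dh) (Fin dy) ℝ) (b : Vec dh)
    (δ ρ₁ ρ₂ : ℝ) (x : Vec dx) (u : Vec dh) : VecPair dy dh :=
  argminOn (slackDomain dy dh) fun y' => augLag f g A b δ ρ₁ ρ₂ x y' 0 u 0

/-- `z'*(x, v)`, the maximizer of `K(x, y', ·, u, v)` over `𝒫_y`. The arguments `y'`, `u` only
contribute an additive constant and are set to `0`. -/
def zAugStar (f g : VecPair dx dy → ℝ) (A : Matrix (Fin dh) (Fin dy) ℝ) (b : Vec dh)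
    (δ ρ₁ ρ₂ : ℝ) (x : Vec dx) (v : Vec dh) : VecPair dy dh :=
  argminOn (slackDomain dy dh) fun z' => -augLag f g A b δ ρ₁ ρ₂ x 0 z' 0 v

/-! ### The algorithm -/

/-- The variables `(x, y', z', u, v)` of the algorithm. -/
structure State (dx dy dh : ℕ) where
  x : Vec dx
  y' : VecPair dy dh
  z' : VecPair dy dh
  u : Vec dh
  v : Vec dh

/-- Step sizes of the algorithm. -/
structure StepSizes where
  ηx : ℝ
  ηy : ℝ
  ηz : ℝ
  ηu : ℝ
  ηv : ℝ

/-- All step sizes are positive. -/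
def StepSizes.Positive (η : StepSizes) : Prop :=
  0 < η.ηx ∧ 0 < η.ηy ∧ 0 < η.ηz ∧ 0 < η.ηu ∧ 0 < η.ηv

/-- One iteration of SFLCB: multiplier ascent and descent steps first, then, with the new
multipliers, a gradient step in `x` and projected gradient steps in `y'` and `z'`. -/
def sflcbStep (f g : VecPair dx dy → ℝ) (A : Matrix (Fin dh) (Fin dy) ℝ) (b : Vec dh)
    (δ ρ₁ ρ₂ : ℝ) (η : StepSizes) (s : State dx dy dh) : State dx dy dh :=
  let u₁ := s.u + η.ηu • residual A b s.y'
  let v₁ := s.v + η.ηv • residual A b s.z'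
  { x := s.x - η.ηx • gradient (fun x => augLag f g A b δ ρ₁ ρ₂ x s.y' s.z' u₁ v₁) s.x
    y' := projSlack
      (s.y' - η.ηy • gradient (fun y' => augLag f g A b δ ρ₁ ρ₂ s.x y' s.z' u₁ v₁) s.y')
    z' := projSlack
      (s.z' + η.ηz • gradient (fun z' => augLag f g A b δ ρ₁ ρ₂ s.x s.y' z' u₁ v₁) s.z')
    u := u₁
    v := v₁ }

/-- The state of SFLCB after `t` iterations started at `s₀`. -/
def sflcb (f g : VecPair dx dy → ℝ) (A : Matrix (Fin dh) (Fin dy) ℝ) (b : Vec dh)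
    (δ ρ₁ ρ₂ : ℝ) (η : StepSizes) (s₀ : State dx dy dh) (t : ℕ) : State dx dy dh :=
  (sflcbStep f g A b δ ρ₁ ρ₂ η)^[t] s₀

/-- Admissible initialization: `y'₀, z'₀ ∈ 𝒫_y`. -/
def State.Admissible (s : State dx dy dh) : Prop :=
  s.y' ∈ slackDomain dy dh ∧ s.z' ∈ slackDomain dy dh

/-- The closeness and feasibility-residual conditions on the initial point, each with bound `r`. -/
structure InitClose (f g : VecPair dx dy → ℝ) (A : Matrix (Fin dh) (Fin dy) ℝ) (b : Vec dh)
    (δ ρ₁ ρ₂ r : ℝ) (s : State dx dy dh) : Prop where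
  y_close : ‖s.y'.fst - yStar f g A b δ s.x‖ ≤ r
  yAug_residual : ‖residual A b (yAugStar f g A b δ ρ₁ ρ₂ s.x s.u)‖ ≤ r
  y_residual : ‖residual A b s.y'‖ ≤ r
  z_close : ‖s.z'.fst - zStar g A b s.x‖ ≤ r
  zAug_residual : ‖residual A b (zAugStar f g A b δ ρ₁ ρ₂ s.x s.v)‖ ≤ r
  z_residual : ‖residual A b s.z'‖ ≤ r

end

end SFLCB

namespace SFLCB

noncomputable section

/-! ### Two-sided quadratic bounds -/

section QuadBounds

variable {X : Type*} [NormedAddCommGroup X] [InnerProductSpace ℝ X]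

/-! Minimizing `δ f + g` (variable `y`, multiplier `u`) and minimizing `g` (variable `z`, multiplier
`v`) over the feasible set are two instances of one problem. Since `2 lf1 δ ≤ μg`, both objectives
are `μg/2`-strongly convex in the lower variable and share the gradient constant `lg1 + μg/2`, so
the step sizes can be chosen independently of `δ`. The difference of the two optimal values,
`valueGap`, equals `δ Φ_δ`; it is smooth, and its gradient is the `x`-direction of the algorithm
evaluated at the exact solutions.

The proof is a descent argument for `potential`: `valueGap` plus, for each inner problem, `merit`,
the primal gap plus the dual gap of the augmented Lagrangian. The multiplier step gains the squared
residual at the Lagrangian minimizer, the projected gradient step gains the squared distance to that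
minimizer, and moving `x` costs terms which these gains absorb (`exists_merit_decrease`).

The gains must also control the distance from the iterate to the constrained solution. This is
`exists_error_bound`: the Lagrangian minimizer solves the constrained problem with right-hand side
shifted by its residual, and the minimizer of a strongly convex smooth function over a polyhedron is
Lipschitz in the right-hand side (`exists_argmin_lipschitz_rhs`). No rank condition on `A` is
needed, because multipliers can be chosen with linearly independent support and there are finitely
many supports.

Hence each iteration lowers the potential by `ηx/2 ‖∇ valueGap‖²` (`exists_stepSizes`), while the
potential stays above `δ inf Φ - O(δ²)`. A point that is not `ε`-stationary costs at least a
multiple of `δ² ε²`. With `δ` of order `ε`, an initial excess `O(1)` gives `ε⁻⁴` iterations and an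
excess `O(δ (1 + ‖u₀‖ + ‖v₀‖))` gives `ε⁻³`. -/

theorem nonneg_of_forall_add_mul_nonneg {a c : ℝ}
    (h : ∀ t : ℝ, 0 < t → t ≤ 1 → 0 ≤ a + t * c) : 0 ≤ a := by
  by_contra! ha
  have hc : 0 < |c| + 1 := by positivity
  have h1 := h (min 1 (-a / (2 * (|c| + 1)))) (by
    apply lt_min one_pos
    apply div_pos <;> linarith) (min_le_left _ _)
  set t := min 1 (-a / (2 * (|c| + 1)))
  have ht : t ≤ -a / (2 * (|c| + 1)) := min_le_right _ _
  have ht0 : 0 < t := lt_min one_pos (div_pos (by linarith) (by linarith))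
  rw [le_div_iff₀ (by linarith)] at ht
  nlinarith [le_abs_self c]

/-- The remainder of the first-order expansion of `φ` with gradient field `M` lies between
`m/2 ‖q - p‖²` and `L/2 ‖q - p‖²`. -/
structure QuadBounds (m L : ℝ) (φ : X → ℝ) (M : X → X) : Prop where
  lower : ∀ p q, φ p + inner ℝ (M p) (q - p) + m / 2 * ‖q - p‖ ^ 2 ≤ φ q
  upper : ∀ p q, φ q ≤ φ p + inner ℝ (M p) (q - p) + L / 2 * ‖q - p‖ ^ 2

/-- The descent lemma with both signs treated at once: along the segment, `s` times the first-order
remainder minus `L/2 t² ‖q - p‖²` has nonpositive derivative, by Cauchy-Schwarz. -/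
theorem QuadBounds.of_lipschitz_gradient [CompleteSpace X] {φ : X → ℝ} {L : ℝ≥0}
    (hφ : Differentiable ℝ φ) (hL : LipschitzWith L (gradient φ)) :
    QuadBounds (-L : ℝ) L φ (gradient φ) := by
  have key : ∀ p q : X, ∀ s : ℝ, s = 1 ∨ s = -1 →
      s * (φ q - φ p - inner ℝ (gradient φ p) (q - p)) ≤ L / 2 * ‖q - p‖ ^ 2 := by
    intro p q s hs
    let F : ℝ → ℝ := fun t => s * (φ (p + t • (q - p)) - t * inner ℝ (gradient φ p) (q - p))
      - L / 2 * t ^ 2 * ‖q - p‖ ^ 2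
    have hderiv : ∀ t : ℝ, HasDerivAt F
        (s * (inner ℝ (gradient φ (p + t • (q - p))) (q - p) - inner ℝ (gradient φ p) (q - p))
          - L * t * ‖q - p‖ ^ 2) t := by
      intro t
      have h1 : HasDerivAt (fun t : ℝ => p + t • (q - p)) (q - p) t := by
        simpa using ((hasDerivAt_id t).smul_const (q - p)).const_add p
      have h2 : HasDerivAt (fun t : ℝ => φ (p + t • (q - p)))
          (inner ℝ (gradient φ (p + t • (q - p))) (q - p)) t := by
        have h3 := ((hφ (p + t • (q - p))).hasGradientAt.hasFDerivAt).comp_hasDerivAt t h1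
        exact h3
      have h4 : HasDerivAt (fun t : ℝ => t * inner ℝ (gradient φ p) (q - p))
          (inner ℝ (gradient φ p) (q - p)) t := by
        simpa using (hasDerivAt_id t).mul_const (inner ℝ (gradient φ p) (q - p))
      have h5 : HasDerivAt (fun t : ℝ => L / 2 * t ^ 2 * ‖q - p‖ ^ 2)
          (L * t * ‖q - p‖ ^ 2) t := by
        have := ((hasDerivAt_pow 2 t).const_mul ((L : ℝ) / 2)).mul_const (‖q - p‖ ^ 2)
        exact this.congr_deriv (by rw [show 2 - 1 = 1 from rfl]; push_cast; ring)
      exact ((h2.sub h4).const_mul s).sub h5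
    have hanti : AntitoneOn F (Set.Icc 0 1) := by
      apply antitoneOn_of_deriv_nonpos (convex_Icc 0 1)
      · exact fun t _ => (hderiv t).continuousAt.continuousWithinAt
      · exact fun t _ => (hderiv t).differentiableAt.differentiableWithinAt
      · intro t ht
        rw [interior_Icc] at ht
        rw [(hderiv t).deriv, ← inner_sub_left]
        have h1 := abs_real_inner_le_norm (gradient φ (p + t • (q - p)) - gradient φ p) (q - p)
        have h2 := hL.dist_le_mul (p + t • (q - p)) p
        rw [dist_eq_norm, dist_eq_norm, add_sub_cancel_left, norm_smul, Real.norm_eq_abs,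
          abs_of_pos ht.1] at h2
        have h3 : s * inner ℝ (gradient φ (p + t • (q - p)) - gradient φ p) (q - p) ≤
            |inner ℝ (gradient φ (p + t • (q - p)) - gradient φ p) (q - p)| := by
          rcases hs with rfl | rfl
          · simpa using le_abs_self _
          · simpa using neg_le_abs _
        nlinarith [mul_le_mul_of_nonneg_right h2 (norm_nonneg (q - p))]
    have h := hanti (Set.left_mem_Icc.2 zero_le_one) (Set.right_mem_Icc.2 zero_le_one) zero_le_one
    simp only [F] at h
    simp only [one_smul, zero_smul, add_zero, add_sub_cancel] at h
    linarith
  constructor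
  · intro p q
    have := key p q (-1) (Or.inr rfl)
    linarith
  · intro p q
    have := key p q 1 (Or.inl rfl)
    linarith

variable {m L : ℝ} {φ : X → ℝ} {M : X → X}

theorem QuadBounds.mono (h : QuadBounds m L φ M) {m' L' : ℝ} (hm : m' ≤ m) (hL : L ≤ L') :
    QuadBounds m' L' φ M where
  lower p q := by
    have := h.lower p q
    nlinarith [sq_nonneg ‖q - p‖]
  upper p q := by
    have := h.upper p q
    nlinarith [sq_nonneg ‖q - p‖]

theorem QuadBounds.add (h : QuadBounds m L φ M) {m' L' : ℝ} {φ' : X → ℝ} {M' : X → X}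
    (h' : QuadBounds m' L' φ' M') :
    QuadBounds (m + m') (L + L') (fun p => φ p + φ' p) (fun p => M p + M' p) where
  lower p q := by
    have := h.lower p q
    have := h'.lower p q
    rw [inner_add_left]
    linarith
  upper p q := by
    have := h.upper p q
    have := h'.upper p q
    rw [inner_add_left]
    linarith

theorem QuadBounds.const_mul (h : QuadBounds m L φ M) {c : ℝ} (hc : 0 ≤ c) :
    QuadBounds (c * m) (c * L) (fun p => c * φ p) (fun p => c • M p) where
  lower p q := by
    have := mul_le_mul_of_nonneg_left (h.lower p q) hc
    rw [real_inner_smul_left]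
    linarith
  upper p q := by
    have := mul_le_mul_of_nonneg_left (h.upper p q) hc
    rw [real_inner_smul_left]
    linarith

theorem QuadBounds.neg (h : QuadBounds m L φ M) :
    QuadBounds (-L) (-m) (fun p => -φ p) (fun p => -M p) where
  lower p q := by
    have := h.upper p q
    rw [inner_neg_left]
    linarith
  upper p q := by
    have := h.lower p q
    rw [inner_neg_left]
    linarith

theorem QuadBounds.sub (h : QuadBounds m L φ M) {m' L' : ℝ} {φ' : X → ℝ} {M' : X → X}
    (h' : QuadBounds m' L' φ' M') :
    QuadBounds (m - L') (L - m') (fun p => φ p - φ' p) (fun p => M p - M' p) := by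
  simpa only [sub_eq_add_neg] using h.add h'.neg

theorem QuadBounds.add_const (h : QuadBounds m L φ M) (c : ℝ) :
    QuadBounds m L (fun p => φ p + c) M where
  lower p q := by
    have := h.lower p q
    linarith
  upper p q := by
    have := h.upper p q
    linarith

/-- The bounds make the first-order remainder `O(‖q - p‖²)`. Value functions, for which only such
bounds are proved, become differentiable in this way. -/
theorem QuadBounds.hasGradientAt [CompleteSpace X] (h : QuadBounds m L φ M) (p : X) :
    HasGradientAt φ (M p) p := by
  rw [hasGradientAt_iff_isLittleO]
  have h1 : (fun q => φ q - φ p - inner ℝ (M p) (q - p)) =O[nhds p] fun q => ‖q - p‖ ^ 2 := by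
    apply Asymptotics.IsBigO.of_bound (|m| + |L|)
    filter_upwards with q
    rw [Real.norm_eq_abs, Real.norm_eq_abs, abs_of_nonneg (sq_nonneg ‖q - p‖), abs_le]
    have := h.lower p q
    have := h.upper p q
    constructor <;>
      nlinarith [sq_nonneg ‖q - p‖, neg_abs_le m, le_abs_self L, abs_nonneg m, abs_nonneg L,
        mul_nonneg (abs_nonneg m) (sq_nonneg ‖q - p‖),
        mul_nonneg (abs_nonneg L) (sq_nonneg ‖q - p‖)]
  refine h1.trans_isLittleO ?_
  have h2 : (fun q => ‖q - p‖ ^ 2) =o[nhds p] fun q => ‖q - p‖ := by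
    have h3 : Filter.Tendsto (fun q => ‖q - p‖) (nhds p) (nhds 0) := by
      have : Continuous fun q => ‖q - p‖ := by fun_prop
      simpa using this.tendsto p
    exact (Asymptotics.isLittleO_pow_id one_lt_two).comp_tendsto h3
  exact h2.of_norm_right

theorem QuadBounds.continuous [CompleteSpace X] (h : QuadBounds m L φ M) : Continuous φ :=
  continuous_iff_continuousAt.2 fun p => (h.hasGradientAt p).continuousAt

theorem QuadBounds.strongly_monotone (h : QuadBounds m L φ M) (p q : X) :
    m * ‖p - q‖ ^ 2 ≤ inner ℝ (M p - M q) (p - q) := by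
  have h1 := h.lower p q
  have h2 := h.lower q p
  rw [norm_sub_rev q p, ← neg_sub p q, inner_neg_right] at h1
  rw [inner_sub_left]
  linarith

/-- First-order optimality over a convex set. -/
theorem QuadBounds.variational (h : QuadBounds m L φ M) {S : Set X} (hS : Convex ℝ S) {p q : X}
    (hp : p ∈ S) (hmin : IsMinOn φ S p) (hq : q ∈ S) : 0 ≤ inner ℝ (M p) (q - p) := by
  apply nonneg_of_forall_add_mul_nonneg (c := L / 2 * ‖q - p‖ ^ 2)
  intro t ht ht1
  have h1 : p + t • (q - p) ∈ S := hS.add_smul_sub_mem hp hq ⟨ht.le, ht1⟩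
  have h2 : φ p ≤ φ (p + t • (q - p)) := hmin h1
  have h3 := h.upper p (p + t • (q - p))
  rw [add_sub_cancel_left, real_inner_smul_right, norm_smul, Real.norm_eq_abs, abs_of_pos ht] at h3
  have : 0 ≤ t * (inner ℝ (M p) (q - p) + t * (L / 2 * ‖q - p‖ ^ 2)) := by nlinarith
  exact nonneg_of_mul_nonneg_right this ht

theorem QuadBounds.growth (h : QuadBounds m L φ M) {S : Set X} (hS : Convex ℝ S) {p q : X}
    (hp : p ∈ S) (hmin : IsMinOn φ S p) (hq : q ∈ S) : φ p + m / 2 * ‖q - p‖ ^ 2 ≤ φ q := by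
  have := h.lower p q
  have := h.variational hS hp hmin hq
  linarith

theorem QuadBounds.exists_isMinOn [FiniteDimensional ℝ X] (h : QuadBounds m L φ M) (hm : 0 < m)
    {S : Set X} (hS : IsClosed S) (hne : S.Nonempty) : ∃ p, p ∈ S ∧ IsMinOn φ S p := by
  have : CompleteSpace X := FiniteDimensional.complete ℝ X
  obtain ⟨p₀, hp₀⟩ := hne
  apply h.continuous.continuousOn.exists_isMinOn' hS hp₀
  apply Filter.Eventually.filter_mono inf_le_left
  -- Beyond this radius the quadratic term of the lower bound at `p₀` outweighs the linear one.
  filter_upwards [(isCompact_closedBall p₀ (2 * ‖M p₀‖ / m)).compl_mem_cocompact] with q hq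
  have hq' : 2 * ‖M p₀‖ / m < ‖q - p₀‖ := by simpa [dist_eq_norm] using hq
  rw [div_lt_iff₀ hm] at hq'
  have h1 := h.lower p₀ q
  have h2 := neg_le_of_abs_le (abs_real_inner_le_norm (M p₀) (q - p₀))
  nlinarith [norm_nonneg (q - p₀)]

/-- Stability of minimizers with respect to the objective. -/
theorem QuadBounds.norm_sub_argmin_le (h : QuadBounds m L φ M) (hm : 0 < m) {L' : ℝ}
    {φ' : X → ℝ} {M' : X → X} (h' : QuadBounds m L' φ' M') {S : Set X} (hS : Convex ℝ S)
    {p p' : X} (hp : p ∈ S) (hmin : IsMinOn φ S p) (hp' : p' ∈ S) (hmin' : IsMinOn φ' S p') :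
    ‖p - p'‖ ≤ ‖M p' - M' p'‖ / m := by
  have h1 := h.variational hS hp hmin hp'
  have h2 := h'.variational hS hp' hmin' hp
  have h3 := h.strongly_monotone p p'
  have h4 := neg_le_of_abs_le (abs_real_inner_le_norm (M p' - M' p') (p - p'))
  rw [inner_sub_left] at h3 h4
  rw [← neg_sub p p', inner_neg_right] at h1
  rw [le_div_iff₀ hm]
  by_contra! hlt
  have h5 : 0 < ‖p - p'‖ := by
    by_contra! h0
    have : ‖p - p'‖ = 0 := le_antisymm h0 (norm_nonneg _)
    rw [this] at hlt
    linarith [norm_nonneg (M p' - M' p')]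
  nlinarith

/-- One step of the projected gradient method on a smooth strongly convex function. -/
theorem QuadBounds.projected_gradient (h : QuadBounds m L φ M) (hm : 0 < m) {S : Set X}
    {η : ℝ} (hη : 0 < η) (hηL : η * L ≤ 1) {y y₁ p : X} (hy : y ∈ S) (hy₁ : y₁ ∈ S)
    (hproj : ∀ q ∈ S, inner ℝ (y - η • M y - y₁) (q - y₁) ≤ 0)
    (hp : p ∈ S) (hmin : IsMinOn φ S p) :
    φ y₁ ≤ φ y - η * m ^ 2 / 8 * ‖y - p‖ ^ 2 ∧ ‖y₁ - p‖ ≤ ‖y - p‖ := by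
  -- The three-point inequality: `q = p` gives contraction towards the minimizer, `q = y` gives
  -- descent by the squared step length.
  have key : ∀ q ∈ S, 2 * η * (φ y₁ - φ q) ≤
      (1 - η * m) * ‖y - q‖ ^ 2 - ‖y₁ - q‖ ^ 2 := by
    intro q hq
    have h1 := hproj q hq
    have h2 := h.upper y y₁
    have h3 := h.lower y q
    have e1 : y - η • M y - y₁ = (y - q) - (y₁ - q) - η • M y := by abel
    have e2 : q - y₁ = -(y₁ - q) := by abel
    have e3 : y₁ - y = (y₁ - q) - (y - q) := by abel
    have e4 : q - y = -(y - q) := by abel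
    rw [e1, e2] at h1
    rw [e3] at h2
    rw [e4] at h3
    generalize y - q = a at *
    generalize y₁ - q = c at *
    have e5 : ‖c - a‖ ^ 2 = ‖c‖ ^ 2 - 2 * inner ℝ a c + ‖a‖ ^ 2 := by
      rw [norm_sub_sq_real, real_inner_comm]
    simp only [inner_neg_right, inner_sub_left, inner_sub_right, real_inner_smul_left,
      real_inner_self_eq_norm_sq, norm_neg] at h1 h2 h3
    have h4 : η * L * ‖c - a‖ ^ 2 ≤ 1 * ‖c - a‖ ^ 2 :=
      mul_le_mul_of_nonneg_right hηL (sq_nonneg _)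
    have h5 := mul_le_mul_of_nonneg_left h2 hη.le
    have h6 := mul_le_mul_of_nonneg_left h3 hη.le
    nlinarith
  have k1 := key p hp
  have k2 := key y hy
  have hp1 : φ p ≤ φ y₁ := hmin hy₁
  rw [sub_self, norm_zero] at k2
  have n1 := norm_nonneg (y - p)
  have n2 := norm_nonneg (y₁ - p)
  have hle : ‖y₁ - p‖ ^ 2 ≤ (1 - η * m) * ‖y - p‖ ^ 2 := by
    nlinarith [mul_nonneg (mul_nonneg zero_le_two hη.le) (sub_nonneg.2 hp1)]
  have hηm : 0 < η * m := mul_pos hη hm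
  have hle2 : ‖y₁ - p‖ ≤ ‖y - p‖ := by
    apply le_of_sq_le_sq _ n1
    nlinarith [sq_nonneg ‖y - p‖]
  refine ⟨?_, hle2⟩
  have htri : ‖y - p‖ ≤ ‖y₁ - y‖ + ‖y₁ - p‖ := by
    have := norm_sub_le_norm_sub_add_norm_sub y y₁ p
    rwa [norm_sub_rev y y₁] at this
  -- A shorter step would contradict the contraction `hle`, because `(1 - η m / 2)² ≥ 1 - η m`.
  -- Squared, this lower bound turns descent in the step length into descent in the distance to `p`.
  have hhalf : η * m / 2 * ‖y - p‖ ≤ ‖y₁ - y‖ := by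
    by_contra! hlt
    have h7 : ‖y - p‖ * (1 - η * m / 2) < ‖y₁ - p‖ := by nlinarith
    have hpos : 0 < ‖y - p‖ := by
      by_contra! h0
      nlinarith [norm_nonneg (y₁ - y)]
    have hηm1 : η * m ≤ 1 := by
      by_contra! h1
      nlinarith [sq_nonneg ‖y₁ - p‖, mul_pos hpos hpos]
    have h8 : 0 ≤ ‖y - p‖ * (1 - η * m / 2) := mul_nonneg n1 (by linarith)
    have h9 : (‖y - p‖ * (1 - η * m / 2)) ^ 2 < ‖y₁ - p‖ ^ 2 := by
      apply pow_lt_pow_left₀ h7 h8 two_ne_zero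
    nlinarith [sq_nonneg (η * m * ‖y - p‖)]
  have hsq : (η * m / 2 * ‖y - p‖) ^ 2 ≤ ‖y₁ - y‖ ^ 2 :=
    pow_le_pow_left₀ (by positivity) hhalf 2
  have h10 : 2 * η * (φ y₁ - φ y) ≤ 2 * η * (-(η * m ^ 2 / 8 * ‖y - p‖ ^ 2)) := by nlinarith
  have := le_of_mul_le_mul_left h10 (by positivity)
  linarith

end QuadBounds

/-! ### Marginal functions -/

section Marginal

variable {E X : Type*} [NormedAddCommGroup E] [InnerProductSpace ℝ E] [NormedAddCommGroup X]
  [InnerProductSpace ℝ X]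

/-- A smooth function of `(x, q)` that is strongly convex in `q`, with partial gradients `Gx` and
`M`. -/
structure SmoothFamily (m L L' : ℝ) (φ : E → X → ℝ) (Gx : E → X → E) (M : E → X → X) : Prop where
  quad_left : ∀ q, QuadBounds (-L) L (fun x => φ x q) (fun x => Gx x q)
  quad_right : ∀ x, QuadBounds m L' (φ x) (M x)
  lip_left : ∀ x q q', ‖Gx x q - Gx x q'‖ ≤ L * ‖q - q'‖
  lip_right : ∀ x x' q, ‖M x q - M x' q‖ ≤ L * ‖x - x'‖

/-- Quadratic bounds for the value function of a family of strongly convex problems. -/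
theorem SmoothFamily.marginal {m L L' : ℝ} {φ : E → X → ℝ} {Gx : E → X → E} {M : E → X → X}
    (h : SmoothFamily m L L' φ Gx M) (hm : 0 < m) (hL : 0 ≤ L) {S : Set X} (hS : Convex ℝ S)
    {q : E → X} (hq : ∀ x, q x ∈ S) (hmin : ∀ x, IsMinOn (φ x) S (q x)) :
    QuadBounds (-(L + 2 * L ^ 2 / m)) L (fun x => φ x (q x)) (fun x => Gx x (q x)) where
  lower x x' := by
    have h1 : φ x (q x) ≤ φ x (q x') := hmin x (hq x')
    have h2 := (h.quad_left (q x')).lower x x'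
    have h3 := h.lip_left x (q x) (q x')
    -- The comparison point `q x'` brings in the gradient at `q x'` instead of `q x`; stability of
    -- minimizers bounds the discrepancy and produces the extra `2 L² / m`.
    have h4 := (h.quad_right x).norm_sub_argmin_le hm (h.quad_right x') hS (hq x) (hmin x) (hq x')
      (hmin x')
    have h5 := h.lip_right x x' (q x')
    have h6 := le_of_abs_le (abs_real_inner_le_norm (Gx x (q x) - Gx x (q x')) (x' - x))
    rw [inner_sub_left] at h6
    have h7 : ‖Gx x (q x) - Gx x (q x')‖ ≤ L ^ 2 / m * ‖x' - x‖ := by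
      rw [norm_sub_rev x' x]
      calc _ ≤ L * ‖q x - q x'‖ := h3
        _ ≤ L * (L * ‖x - x'‖ / m) := by gcongr; exact h4.trans (by gcongr)
        _ = _ := by ring
    have h8 := mul_le_mul_of_nonneg_right h7 (norm_nonneg (x' - x))
    have e : -(L + 2 * L ^ 2 / m) / 2 = -L / 2 - L ^ 2 / m := by ring
    rw [e]
    nlinarith
  upper x x' := by
    have h1 : φ x' (q x') ≤ φ x' (q x) := hmin x' (hq x)
    have h2 := (h.quad_left (q x)).upper x x'
    linarith

end Marginal

/-! ### Polyhedral constraints -/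

section Polyhedral

open Filter Topology

variable {n : ℕ}

/-- Conic Carathéodory: a nonnegative combination can be rewritten with independent support. -/
theorem exists_independent_support {E : Type*} [AddCommGroup E] [Module ℝ E]
    (S : Vec n →ₗ[ℝ] E) (l : Vec n) (hl : ∀ i, 0 ≤ l i) :
    ∃ l' : Vec n, (∀ i, 0 ≤ l' i) ∧ (∀ i, l i = 0 → l' i = 0) ∧ S l' = S l ∧
      ∀ ν : Vec n, (∀ i, l' i = 0 → ν i = 0) → S ν = 0 → ν = 0 := by
  induction hk : (Finset.univ.filter fun i => l i ≠ 0).card using Nat.strong_induction_on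
    generalizing l with
  | _ k ih =>
  by_cases hind : ∀ ν : Vec n, (∀ i, l i = 0 → ν i = 0) → S ν = 0 → ν = 0
  · exact ⟨l, hl, fun _ => id, rfl, hind⟩
  push Not at hind
  obtain ⟨ν, hν, hSν, hν0⟩ : ∃ ν : Vec n, (∀ i, l i = 0 → ν i = 0) ∧ S ν = 0 ∧ ∃ i, 0 < ν i := by
    obtain ⟨ν, hν, hSν, hν0⟩ := hind
    obtain ⟨i, hi⟩ : ∃ i, ν i ≠ 0 := by
      by_contra! h
      exact hν0 (by ext i; simpa using h i)
    rcases lt_or_gt_of_ne hi with h | h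
    · exact ⟨-ν, fun i hi => by simp [hν i hi], by simp [hSν], i, by simpa using h⟩
    · exact ⟨ν, hν, hSν, i, h⟩
  -- Ratio test: subtracting the smallest ratio times `ν` keeps all coefficients nonnegative and
  -- annihilates coordinate `i₀`, so the support shrinks.
  obtain ⟨i₀, hi₀, hmin⟩ := Finset.exists_min_image (Finset.univ.filter fun i => 0 < ν i)
    (fun i => l i / ν i) (by obtain ⟨i, hi⟩ := hν0; exact ⟨i, by simpa using hi⟩)
  have hi₀' : 0 < ν i₀ := by simpa using hi₀
  set θ := l i₀ / ν i₀ with hθ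
  have hθ0 : 0 ≤ θ := div_nonneg (hl i₀) hi₀'.le
  have hl1 : ∀ i, 0 ≤ (l - θ • ν) i := by
    intro i
    simp only [PiLp.sub_apply, PiLp.smul_apply, smul_eq_mul]
    rcases lt_or_ge 0 (ν i) with h | h
    · have := hmin i (by simpa using h)
      rw [le_div_iff₀ h] at this
      linarith
    · nlinarith [hl i]
  have hz : ∀ i, l i = 0 → (l - θ • ν) i = 0 := by
    intro i hi
    simp [hi, hν i hi]
  have hz0 : (l - θ • ν) i₀ = 0 := by
    simp only [PiLp.sub_apply, PiLp.smul_apply, smul_eq_mul, hθ]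
    field_simp
    ring
  have hlt : (Finset.univ.filter fun i => (l - θ • ν) i ≠ 0).card < k := by
    rw [← hk]
    apply Finset.card_lt_card
    rw [Finset.ssubset_iff_of_subset]
    · refine ⟨i₀, ?_, ?_⟩
      · simp only [Finset.mem_filter, Finset.mem_univ, true_and]
        exact fun h => hi₀'.ne' (hν i₀ h)
      · rw [Finset.mem_filter]
        exact fun h => h.2 hz0
    · intro i
      simp only [Finset.mem_filter, Finset.mem_univ, true_and]
      exact fun h h' => h (hz i h')
  obtain ⟨l', h1, h2, h3, h4⟩ := ih _ hlt (l - θ • ν) hl1 rfl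
  exact ⟨l', h1, fun i hi => h2 i (hz i hi), by rw [h3, map_sub, map_smul, hSν]; simp, h4⟩

/-- A bound on coefficient vectors with independent support, uniform over all supports. -/
theorem exists_norm_le_of_independent_support {E : Type*} [NormedAddCommGroup E] [NormedSpace ℝ E]
    (S : Vec n →ₗ[ℝ] E) :
    ∃ C : ℝ, 0 < C ∧ ∀ I : Finset (Fin n), (∀ ν : Vec n, (∀ i ∉ I, ν i = 0) → S ν = 0 → ν = 0) →
      ∀ ν : Vec n, (∀ i ∉ I, ν i = 0) → ‖ν‖ ≤ C * ‖S ν‖ := by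
  have h : ∀ I : Finset (Fin n), ∃ C : ℝ, 0 ≤ C ∧
      ((∀ ν : Vec n, (∀ i ∉ I, ν i = 0) → S ν = 0 → ν = 0) →
        ∀ ν : Vec n, (∀ i ∉ I, ν i = 0) → ‖ν‖ ≤ C * ‖S ν‖) := by
    intro I
    by_cases hI : ∀ ν : Vec n, (∀ i ∉ I, ν i = 0) → S ν = 0 → ν = 0
    · let W : Submodule ℝ (Vec n) :=
        { carrier := {ν | ∀ i ∉ I, ν i = 0}
          add_mem' := fun {a c} ha hc i hi => by simp [ha i hi, hc i hi]
          zero_mem' := fun i _ => rfl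
          smul_mem' := fun c a ha i hi => by simp [ha i hi] }
      obtain ⟨K, -, hK⟩ := (S.domRestrict W).exists_antilipschitzWith (by
        rw [LinearMap.ker_eq_bot']
        rintro ⟨ν, hν⟩ h0
        exact Subtype.ext (hI ν hν h0))
      refine ⟨K, K.2, fun _ ν hν => ?_⟩
      have := hK.le_mul_dist ⟨ν, hν⟩ 0
      simpa [dist_eq_norm] using this
    · exact ⟨0, le_rfl, fun h => absurd h hI⟩
  choose C hC0 hC using h
  -- There are finitely many supports, so the sum of their constants serves all of them; the `1`
  -- ensures positivity.
  refine ⟨1 + ∑ I, C I, add_pos_of_pos_of_nonneg one_pos (Finset.sum_nonneg fun I _ => hC0 I),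
    fun I hI ν hν => (hC I hI ν hν).trans ?_⟩
  gcongr
  have := Finset.single_le_sum (fun J _ => hC0 J) (Finset.mem_univ I)
  linarith

/-- The halved squared distance from `S l` to `c` as a function of `l`. -/
theorem quadBounds_norm_sub_sq {E F : Type*} [NormedAddCommGroup E] [InnerProductSpace ℝ E]
    [FiniteDimensional ℝ E] [NormedAddCommGroup F] [InnerProductSpace ℝ F]
    [FiniteDimensional ℝ F] (S : F →ₗ[ℝ] E) (c : E) :
    QuadBounds 0 (‖LinearMap.toContinuousLinearMap S‖ ^ 2) (fun l => 1 / 2 * ‖S l - c‖ ^ 2)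
      (fun l => LinearMap.adjoint S (S l - c)) := by
  have key : ∀ p q : F, 1 / 2 * ‖S q - c‖ ^ 2 = 1 / 2 * ‖S p - c‖ ^ 2
      + inner ℝ (LinearMap.adjoint S (S p - c)) (q - p) + 1 / 2 * ‖S (q - p)‖ ^ 2 := by
    intro p q
    rw [LinearMap.adjoint_inner_left, show S q - c = (S p - c) + S (q - p) by rw [map_sub]; abel,
      norm_add_sq_real]
    ring
  constructor
  · intro p q
    rw [key p q]
    nlinarith [sq_nonneg ‖S (q - p)‖]
  · intro p q
    rw [key p q]
    have h := (LinearMap.toContinuousLinearMap S).le_opNorm (q - p)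
    have h2 := pow_le_pow_left₀ (norm_nonneg _) h 2
    rw [mul_pow] at h2
    simp only [LinearMap.coe_toContinuousLinearMap'] at h2
    linarith

/-- Farkas' lemma for a finitely generated cone. -/
theorem farkas {E : Type*} [NormedAddCommGroup E] [InnerProductSpace ℝ E] [FiniteDimensional ℝ E]
    (S : Vec n →ₗ[ℝ] E) (I : Set (Fin n)) (c : E)
    (h : ∀ d : E, (∀ i ∈ I, (LinearMap.adjoint S d) i ≤ 0) → inner ℝ c d ≤ 0) :
    ∃ l : Vec n, (∀ i, 0 ≤ l i) ∧ (∀ i ∉ I, l i = 0) ∧ S l = c := by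
  obtain ⟨C, hC0, hC⟩ := exists_norm_le_of_independent_support S
  let K : Set (Vec n) := {l | (∀ i, 0 ≤ l i) ∧ ∀ i ∉ I, l i = 0}
  have hKclosed : IsClosed K := by
    have : K = (⋂ i, {l : Vec n | 0 ≤ l i}) ∩ ⋂ i, ⋂ (_ : i ∉ I), {l : Vec n | l i = 0} := by
      ext l
      simp [K]
    rw [this]
    refine (isClosed_iInter fun i => ?_).inter
      (isClosed_iInter fun i => isClosed_iInter fun _ => ?_)
    · exact isClosed_le continuous_const (by fun_prop)
    · exact isClosed_eq (by fun_prop) continuous_const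
  have hKconv : Convex ℝ K := by
    intro x hx y hy s t hs ht _
    refine ⟨fun i => ?_, fun i hi => ?_⟩
    · have := hx.1 i
      have := hy.1 i
      simp only [PiLp.add_apply, PiLp.smul_apply, smul_eq_mul]
      positivity
    · simp [hx.2 i hi, hy.2 i hi]
  have h0K : (0 : Vec n) ∈ K := ⟨fun i => le_rfl, fun i _ => rfl⟩
  have hcont : Continuous fun l => 1 / 2 * ‖S l - c‖ ^ 2 := by
    have := S.continuous_of_finiteDimensional
    fun_prop
  -- Coefficient vectors need not be bounded, so the minimum is taken over a ball.
  -- Independent-support representatives with `‖S q'‖ ≤ 2 ‖c‖` lie in it, and those with larger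
  -- image do no better than `0`.
  obtain ⟨l, ⟨hlK, -⟩, hl⟩ := ((isCompact_closedBall (0 : Vec n) (C * (2 * ‖c‖))).inter_left
    hKclosed).exists_isMinOn ⟨0, h0K, by simp; positivity⟩ hcont.continuousOn
  have hmin : IsMinOn (fun l => 1 / 2 * ‖S l - c‖ ^ 2) K l := by
    intro q hq
    obtain ⟨q', hq1, hq2, hq3, hq4⟩ := exists_independent_support S q hq.1
    have hb := hC (Finset.univ.filter fun i => q' i ≠ 0)
      (fun ν hν => hq4 ν (fun i hi => hν i (by simpa using hi))) q' (fun i hi => by simpa using hi)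
    have hq'K : q' ∈ K := ⟨hq1, fun i hi => hq2 i (hq.2 i hi)⟩
    simp only [Set.mem_ofPred_eq]
    rw [← hq3]
    by_cases hbig : ‖S q'‖ ≤ 2 * ‖c‖
    · refine hl ⟨hq'K, ?_⟩
      rw [mem_closedBall_zero_iff]
      exact hb.trans (by gcongr)
    · have h1 : 1 / 2 * ‖S l - c‖ ^ 2 ≤ 1 / 2 * ‖S 0 - c‖ ^ 2 :=
        hl ⟨h0K, by simp; positivity⟩
      rw [map_zero, zero_sub, norm_neg] at h1
      have h2 := norm_sub_norm_le (S q') c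
      have h3 : ‖c‖ ^ 2 ≤ ‖S q' - c‖ ^ 2 := pow_le_pow_left₀ (norm_nonneg _) (by linarith) 2
      linarith
  refine ⟨l, hlK.1, hlK.2, ?_⟩
  have hq := quadBounds_norm_sub_sq S c
  have hvar : ∀ ν ∈ K, 0 ≤ inner ℝ (S l - c) (S (ν - l)) := by
    intro ν hν
    have := hq.variational hKconv hlK hmin hν
    rwa [LinearMap.adjoint_inner_left] at this
  have h1 : inner ℝ (S l - c) (S l) ≤ 0 := by
    have := hvar 0 h0K
    rw [zero_sub, map_neg, inner_neg_right] at this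
    linarith
  -- The variational inequality at `l + e_i` shows that `c - S l` is an admissible direction in `h`.
  -- Together with `h1` this forces `S l = c`.
  have h2 : inner ℝ c (-(S l - c)) ≤ 0 := by
    apply h
    intro i hi
    have h3 : l + EuclideanSpace.single i 1 ∈ K := by
      refine ⟨fun j => ?_, fun j hj => ?_⟩
      · have := hlK.1 j
        simp only [PiLp.add_apply, PiLp.single_apply]
        split_ifs <;> linarith
      · have hne : j ≠ i := fun e => hj (e ▸ hi)
        simp [hlK.2 j hj, hne]
    have h4 := hvar _ h3
    rw [add_sub_cancel_left, ← LinearMap.adjoint_inner_left, EuclideanSpace.inner_single_right]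
      at h4
    simpa using h4
  rw [inner_neg_right, real_inner_comm] at h2
  have h5 : ‖S l - c‖ ^ 2 = inner ℝ (S l - c) (S l) - inner ℝ (S l - c) c := by
    rw [← inner_sub_right, real_inner_self_eq_norm_sq]
  have h6 : ‖S l - c‖ = 0 := by nlinarith [norm_nonneg (S l - c)]
  exact sub_eq_zero.1 (norm_eq_zero.1 h6)

/-! ### KKT multipliers and sensitivity to the right-hand side -/

variable {m : ℕ}

/-- The Karush-Kuhn-Tucker conditions for minimizing a function with gradient field `M` over
`{y | A y - b ≤ 0}`. -/
structure IsKKT (A : Matrix (Fin m) (Fin n) ℝ) (b : Vec m) (M : Vec n → Vec n) (y : Vec n)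
    (l : Vec m) : Prop where
  feasible : y ∈ feasibleSet A b
  nonneg : ∀ i, 0 ≤ l i
  complementary : ∀ i, l i = 0 ∨ (Matrix.toEuclideanLin A y - b) i = 0
  stationary : LinearMap.adjoint (Matrix.toEuclideanLin A) l = -M y

theorem convex_feasibleSet (A : Matrix (Fin m) (Fin n) ℝ) (b : Vec m) :
    Convex ℝ (feasibleSet A b) := by
  intro x hx y hy s t hs ht hst i
  have h1 := mul_le_mul_of_nonneg_left (hx i) hs
  have h2 := mul_le_mul_of_nonneg_left (hy i) ht
  simp only [map_add, map_smul, PiLp.sub_apply, PiLp.add_apply, PiLp.smul_apply, smul_eq_mul]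
    at h1 h2 ⊢
  have : b i = s * b i + t * b i := by rw [← add_mul, hst, one_mul]
  linarith

theorem isClosed_feasibleSet (A : Matrix (Fin m) (Fin n) ℝ) (b : Vec m) :
    IsClosed (feasibleSet A b) := by
  have : feasibleSet A b = ⋂ i, {y | (Matrix.toEuclideanLin A y - b) i ≤ 0} := by
    ext
    simp [feasibleSet]
  rw [this]
  refine isClosed_iInter fun i => isClosed_le ?_ continuous_const
  have := (Matrix.toEuclideanLin A).continuous_of_finiteDimensional
  fun_prop

variable {A : Matrix (Fin m) (Fin n) ℝ} {μ L : ℝ} {φ : Vec n → ℝ} {M : Vec n → Vec n}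

/-- Constraints are affine, so a direction that does not increase the active ones stays feasible for
small steps, and Farkas' lemma applies without a constraint qualification. Independent support makes
the multiplier bounded by the gradient. -/
theorem QuadBounds.exists_isKKT (h : QuadBounds μ L φ M) {b : Vec m} {y : Vec n}
    (hy : y ∈ feasibleSet A b) (hmin : IsMinOn φ (feasibleSet A b) y) :
    ∃ l, IsKKT A b M y l ∧ ∀ ν : Vec m, (∀ i, l i = 0 → ν i = 0) →
      LinearMap.adjoint (Matrix.toEuclideanLin A) ν = 0 → ν = 0 := by
  obtain ⟨l, hl1, hl2, hl3⟩ := farkas (LinearMap.adjoint (Matrix.toEuclideanLin A))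
    {i | (Matrix.toEuclideanLin A y - b) i = 0} (-M y) (by
      intro d hd
      rw [LinearMap.adjoint_adjoint] at hd
      have hev : ∀ᶠ t in 𝓝[>] (0 : ℝ), ∀ i,
          (Matrix.toEuclideanLin A (y + t • d) - b) i ≤ 0 := by
        rw [eventually_all]
        intro i
        have e : ∀ t : ℝ, (Matrix.toEuclideanLin A (y + t • d) - b) i =
            (Matrix.toEuclideanLin A y - b) i + t * (Matrix.toEuclideanLin A d) i := by
          intro t
          simp only [map_add, map_smul, PiLp.sub_apply, PiLp.add_apply, PiLp.smul_apply,
            smul_eq_mul]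
          ring
        simp only [e]
        rcases (hy i).lt_or_eq with hi | hi
        · have hc : Continuous fun t : ℝ =>
              (Matrix.toEuclideanLin A y - b) i + t * (Matrix.toEuclideanLin A d) i := by fun_prop
          have := (hc.tendsto 0).eventually_lt_const (u := 0) (by simpa using hi)
          exact (this.filter_mono nhdsWithin_le_nhds).mono fun t ht => ht.le
        · filter_upwards [self_mem_nhdsWithin] with t ht
          rw [hi, zero_add]
          exact mul_nonpos_of_nonneg_of_nonpos (le_of_lt ht) (hd i hi)
      obtain ⟨t, ht, ht0⟩ := (hev.and self_mem_nhdsWithin).exists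
      have := h.variational (convex_feasibleSet A b) hy hmin ht
      rw [add_sub_cancel_left, real_inner_smul_right] at this
      have := nonneg_of_mul_nonneg_right this ht0
      rw [inner_neg_left]
      linarith)
  obtain ⟨l', h1, h2, h3, h4⟩ :=
    exists_independent_support (LinearMap.adjoint (Matrix.toEuclideanLin A)) l hl1
  refine ⟨l', ⟨hy, h1, fun i => ?_, h3.trans hl3⟩, h4⟩
  by_cases hi : (Matrix.toEuclideanLin A y - b) i = 0
  · exact Or.inr hi
  · exact Or.inl (h2 i (hl2 i hi))

/-- Stationarity rewrites strong monotonicity of `M` as a pairing of `l - l'` with `A (y' - y)`;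
complementarity and feasibility replace `A (y' - y)` by `b' - b`. -/
theorem IsKKT.norm_sub_sq_le (h : QuadBounds μ L φ M) {b b' : Vec m} {y y' : Vec n} {l l' : Vec m}
    (hy : IsKKT A b M y l) (hy' : IsKKT A b' M y' l') :
    μ * ‖y - y'‖ ^ 2 ≤ inner ℝ (l - l') (b' - b) := by
  have key : ∀ {b b' : Vec m} {y y' : Vec n} {l l' : Vec m}, IsKKT A b M y l →
      IsKKT A b' M y' l' →
      inner ℝ l (Matrix.toEuclideanLin A (y' - y)) ≤ inner ℝ l (b' - b) := by
    intro b b' y y' l l' hy hy'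
    rw [PiLp.inner_apply, PiLp.inner_apply]
    apply Finset.sum_le_sum
    intro i _
    have h1 := hy'.feasible i
    simp only [map_sub, PiLp.sub_apply, RCLike.inner_apply, conj_trivial] at h1 ⊢
    rcases hy.complementary i with h2 | h2
    · simp [h2]
    · rw [PiLp.sub_apply] at h2
      exact mul_le_mul_of_nonneg_right (by linarith) (hy.nonneg i)
  have h1 := h.strongly_monotone y y'
  have e1 : M y = -LinearMap.adjoint (Matrix.toEuclideanLin A) l := by rw [hy.stationary, neg_neg]
  have e2 : M y' = -LinearMap.adjoint (Matrix.toEuclideanLin A) l' := by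
    rw [hy'.stationary, neg_neg]
  rw [e1, e2, inner_sub_left, inner_neg_left, inner_neg_left, LinearMap.adjoint_inner_left,
    LinearMap.adjoint_inner_left] at h1
  have h2 := key hy hy'
  have h3 := key hy' hy
  rw [← neg_sub y y', map_neg, inner_neg_right] at h2
  rw [← neg_sub b' b, inner_neg_right] at h3
  rw [inner_sub_left]
  linarith

/-- Lipschitz dependence of the minimizer over `{y | A y ≤ b}` on the right-hand side `b`, with a
constant depending only on `A` and on the moduli of the objective. -/
theorem exists_argmin_lipschitz_rhs (A : Matrix (Fin m) (Fin n) ℝ) :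
    ∃ H : ℝ, 0 < H ∧ ∀ (μ L L' : ℝ) (φ : Vec n → ℝ) (M : Vec n → Vec n) (b b' : Vec m)
      (y y' : Vec n), 0 < μ → 0 ≤ L → QuadBounds μ L' φ M → (∀ p q, ‖M p - M q‖ ≤ L * ‖p - q‖) →
      y ∈ feasibleSet A b → IsMinOn φ (feasibleSet A b) y →
      y' ∈ feasibleSet A b' → IsMinOn φ (feasibleSet A b') y' →
      ‖y' - y‖ ≤ H * L / μ * ‖b' - b‖ := by
  obtain ⟨C, hC0, hC⟩ :=
    exists_norm_le_of_independent_support (LinearMap.adjoint (Matrix.toEuclideanLin A))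
  refine ⟨C, hC0, ?_⟩
  intro μ L L' φ M b b' y₀ y₁ hμ hL0 hφ hM hy₀ hmin₀ hy₁ hmin₁
  set r := b' - b with hr
  -- The two right-hand sides are joined by a segment, along which feasibility follows by convex
  -- combination. Outside `[0, 1]` the values are dummies.
  have hex : ∀ s : ℝ, ∃ (y : Vec n) (l : Vec m), s ∈ Set.Icc (0 : ℝ) 1 →
      IsKKT A (b + s • r) M y l ∧ ∀ ν : Vec m, (∀ i, l i = 0 → ν i = 0) →
      LinearMap.adjoint (Matrix.toEuclideanLin A) ν = 0 → ν = 0 := by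
    intro s
    by_cases hs : s ∈ Set.Icc (0 : ℝ) 1
    · have hne : (feasibleSet A (b + s • r)).Nonempty := by
        refine ⟨(1 - s) • y₀ + s • y₁, fun i => ?_⟩
        have h1 := mul_le_mul_of_nonneg_left (hy₀ i) (sub_nonneg.2 hs.2)
        have h2 := mul_le_mul_of_nonneg_left (hy₁ i) hs.1
        simp only [hr, map_add, map_smul, PiLp.sub_apply, PiLp.add_apply, PiLp.smul_apply,
          smul_eq_mul] at h1 h2 ⊢
        linarith
      obtain ⟨y, hy, hmin⟩ := hφ.exists_isMinOn hμ (isClosed_feasibleSet A _) hne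
      obtain ⟨l, hl⟩ := hφ.exists_isKKT hy hmin
      exact ⟨y, l, fun _ => hl⟩
    · exact ⟨0, 0, fun h => absurd h hs⟩
  choose y l hyl using hex
  have hmul : ∀ s t : ℝ, b + s • r - (b + t • r) = (s - t) • r := by
    intro s t
    rw [sub_smul]
    abel
  have hpair : ∀ s ∈ Set.Icc (0 : ℝ) 1, ∀ t ∈ Set.Icc (0 : ℝ) 1,
      μ * ‖y s - y t‖ ^ 2 ≤ ‖l s - l t‖ * (|s - t| * ‖r‖) := by
    intro s hs t ht
    refine (IsKKT.norm_sub_sq_le hφ (hyl s hs).1 (hyl t ht).1).trans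
      ((real_inner_le_norm _ _).trans ?_)
    rw [hmul, norm_smul, Real.norm_eq_abs, abs_sub_comm]
  -- With a common support the difference of multipliers is again independently supported, hence
  -- bounded by `C L ‖y s - y t‖`; one factor cancels in `hpair`.
  have hsame : ∀ s ∈ Set.Icc (0 : ℝ) 1, ∀ t ∈ Set.Icc (0 : ℝ) 1,
      (∀ i, l s i = 0 ↔ l t i = 0) → ‖y s - y t‖ ≤ C * L / μ * ‖r‖ * |s - t| := by
    intro s hs t ht hst
    have h1 := hC (Finset.univ.filter fun i => l s i ≠ 0)
      (fun ν hν => (hyl s hs).2 ν (fun i hi => hν i (by simpa using hi))) (l s - l t)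
      (fun i hi => by
        have h0 : l s i = 0 := by simpa using hi
        simp [h0, (hst i).1 h0])
    rw [map_sub, (hyl s hs).1.stationary, (hyl t ht).1.stationary, neg_sub_neg] at h1
    have h2 : ‖l s - l t‖ ≤ C * (L * ‖y s - y t‖) := by
      refine h1.trans ?_
      gcongr
      rw [norm_sub_rev (y s)]
      exact hM _ _
    have h3 := hpair s hs t ht
    have h4 := mul_le_mul_of_nonneg_right h2 (by positivity : 0 ≤ |s - t| * ‖r‖)
    rw [show C * L / μ * ‖r‖ * |s - t| = C * L * ‖r‖ * |s - t| / μ by ring, le_div_iff₀ hμ]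
    by_contra! hlt
    have h5 : 0 < ‖y s - y t‖ := by
      by_contra! h0
      have : ‖y s - y t‖ = 0 := le_antisymm h0 (norm_nonneg _)
      rw [this, zero_mul] at hlt
      exact absurd hlt (not_lt.2 (by positivity))
    nlinarith
  -- Across different supports the multipliers are merely bounded, which gives a square-root
  -- modulus; that suffices for continuity.
  have hcont : ContinuousOn y (Set.Icc 0 1) := by
    intro t ht
    rw [ContinuousWithinAt, tendsto_iff_norm_sub_tendsto_zero]
    set a := (C * ‖M (y t)‖ + ‖l t‖) * ‖r‖ / μ with ha
    set c := C * L * ‖r‖ / μ with hc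
    have hbd : ∀ s ∈ Set.Icc (0 : ℝ) 1,
        ‖y s - y t‖ ≤ Real.sqrt (2 * |s - t| * a + (|s - t| * c) ^ 2) := by
      intro s hs
      apply Real.le_sqrt_of_sq_le
      have h1 := hC (Finset.univ.filter fun i => l s i ≠ 0)
        (fun ν hν => (hyl s hs).2 ν (fun i hi => hν i (by simpa using hi))) (l s)
        (fun i hi => by simpa using hi)
      rw [(hyl s hs).1.stationary, norm_neg] at h1
      have h2 : ‖M (y s)‖ ≤ ‖M (y t)‖ + L * ‖y s - y t‖ := by
        have := norm_le_norm_add_norm_sub' (M (y s)) (M (y t))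
        have := hM (y s) (y t)
        linarith
      have h3 : ‖l s - l t‖ ≤ C * (‖M (y t)‖ + L * ‖y s - y t‖) + ‖l t‖ :=
        (norm_sub_le _ _).trans (by gcongr; exact h1.trans (by gcongr))
      have h4 := hpair s hs t ht
      have h5 := mul_le_mul_of_nonneg_right h3 (by positivity : 0 ≤ |s - t| * ‖r‖)
      have h6 : ‖y s - y t‖ ^ 2 ≤ |s - t| * a + |s - t| * c * ‖y s - y t‖ := by
        have e : |s - t| * a + |s - t| * c * ‖y s - y t‖ =
            (C * (‖M (y t)‖ + L * ‖y s - y t‖) + ‖l t‖) * (|s - t| * ‖r‖) / μ := by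
          rw [ha, hc]
          ring
        rw [e, le_div_iff₀ hμ]
        linarith
      nlinarith [sq_nonneg (|s - t| * c - ‖y s - y t‖)]
    have hlim : Tendsto (fun s : ℝ => Real.sqrt (2 * |s - t| * a + (|s - t| * c) ^ 2))
        (𝓝[Set.Icc 0 1] t) (𝓝 0) := by
      have hcs : Continuous fun s : ℝ => Real.sqrt (2 * |s - t| * a + (|s - t| * c) ^ 2) := by
        fun_prop
      have := hcs.tendsto t
      simp only [sub_self, abs_zero, mul_zero, zero_mul, zero_pow two_ne_zero, add_zero,
        Real.sqrt_zero] at this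
      exact this.mono_left nhdsWithin_le_nhds
    refine squeeze_zero' (Eventually.of_forall fun s => norm_nonneg _) ?_ hlim
    filter_upwards [self_mem_nhdsWithin] with s hs using hbd s hs
  set Λ := C * L / μ * ‖r‖ with hΛ
  have hΛ0 : 0 ≤ Λ := by positivity
  -- Some support recurs arbitrarily close to the right of `x`, there being finitely many. For `z`
  -- and `w` with that support `hsame` applies, and `w → x` by continuity bounds the slope at `x`
  -- itself, whatever the support at `x`.
  have hslope : ∀ x ∈ Set.Ico (0 : ℝ) 1, ∀ ρ, Λ < ρ →
      ∃ᶠ z in 𝓝[>] x, slope (norm ∘ fun s => y s - y 0) x z < ρ := by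
    intro x hx ρ hρ
    have hmem : ∀ᶠ z in 𝓝[>] x, z ∈ Set.Icc (0 : ℝ) 1 := by
      filter_upwards [Ioo_mem_nhdsGT hx.2] with z hz
      exact ⟨hx.1.trans hz.1.le, hz.2.le⟩
    obtain ⟨I, hI⟩ : ∃ I : Finset (Fin m), ∃ᶠ z in 𝓝[>] x,
        (Finset.univ.filter fun i => l z i ≠ 0) = I := by
      by_contra! hno
      have : ∀ᶠ z in 𝓝[>] x, ∀ I : Finset (Fin m),
          ¬ (Finset.univ.filter fun i => l z i ≠ 0) = I := by
        rw [eventually_all]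
        exact hno
      obtain ⟨z, hz⟩ := this.exists
      exact hz _ rfl
    have hcx : Tendsto y (𝓝[>] x) (𝓝 (y x)) := by
      have h1 : ContinuousWithinAt y (Set.Icc 0 1) x := hcont x ⟨hx.1, hx.2.le⟩
      exact h1.tendsto.mono_left (le_inf inf_le_left (le_principal_iff.2 hmem))
    refine ((hI.and_eventually hmem).and_eventually self_mem_nhdsWithin).mono ?_
    rintro z ⟨⟨hzI, hz⟩, hxz⟩
    have hxz' : x < z := hxz
    have hle : ‖y z - y x‖ ≤ Λ * |z - x| := by
      have ht : Tendsto (fun w => ‖y z - y w‖ - Λ * |z - w|) (𝓝[>] x)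
          (𝓝 (‖y z - y x‖ - Λ * |z - x|)) := by
        have h1 : Tendsto (fun w : ℝ => Λ * |z - w|) (𝓝[>] x) (𝓝 (Λ * |z - x|)) := by
          have : Continuous fun w : ℝ => Λ * |z - w| := by fun_prop
          exact (this.tendsto x).mono_left nhdsWithin_le_nhds
        exact (tendsto_const_nhds.sub hcx).norm.sub h1
      have := le_of_tendsto_of_frequently ht ((hI.and_eventually hmem).mono (by
        rintro w ⟨hwI, hw⟩
        have := hsame z hz w hw (fun i => by
          have := congrArg (fun J => i ∈ J) (hzI.trans hwI.symm)
          simp only [Finset.mem_filter, Finset.mem_univ, true_and, eq_iff_iff] at this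
          tauto)
        exact sub_nonpos.2 this))
      linarith
    rw [abs_of_pos (sub_pos.2 hxz')] at hle
    rw [slope_def_field, div_lt_iff₀ (sub_pos.2 hxz')]
    simp only [Function.comp_apply]
    have h1 := norm_sub_norm_le (y z - y 0) (y x - y 0)
    rw [sub_sub_sub_cancel_right] at h1
    nlinarith [mul_lt_mul_of_pos_right hρ (sub_pos.2 hxz')]
  -- Mean value inequality for a continuous curve, from the lower right slopes of the norm; it
  -- requires a strict bound, hence the limit `K ↓ Λ`.
  have hmain : ‖y 1 - y 0‖ ≤ Λ := by
    refine le_of_forall_gt_imp_ge_of_dense fun K hK => ?_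
    have := image_norm_le_of_liminf_right_slope_norm_lt_deriv_boundary
      (f := fun s => y s - y 0) (f' := fun _ => Λ) (hcont.sub continuousOn_const) hslope
      (B := fun s => K * s) (B' := fun _ => K) (by simp) (by fun_prop)
      (fun x _ => by simpa using ((hasDerivAt_id x).const_mul K).hasDerivWithinAt)
      (fun x _ _ => hK) (Set.right_mem_Icc.2 zero_le_one)
    simpa using this
  have huniq : ∀ s ∈ Set.Icc (0 : ℝ) 1, ∀ w ∈ feasibleSet A (b + s • r),
      IsMinOn φ (feasibleSet A (b + s • r)) w → y s = w := by
    intro s hs w hw hwmin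
    obtain ⟨lw, hlw, -⟩ := hφ.exists_isKKT hw hwmin
    have := IsKKT.norm_sub_sq_le hφ (hyl s hs).1 hlw
    rw [sub_self, inner_zero_right] at this
    have h0 : ‖y s - w‖ ^ 2 ≤ 0 := by
      by_contra! h
      nlinarith
    exact sub_eq_zero.1 (norm_eq_zero.1 (pow_eq_zero_iff two_ne_zero |>.1
      (le_antisymm h0 (sq_nonneg _))))
  have e0 : b + (0 : ℝ) • r = b := by simp
  have e1 : b + (1 : ℝ) • r = b' := by simp [hr]
  rw [← huniq 0 (by simp) y₀ (by rwa [e0]) (by rwa [e0]),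
    ← huniq 1 (by simp) y₁ (by rwa [e1]) (by rwa [e1])]
  exact hmain

end Polyhedral

/-! ### Smooth functions of a pair, strongly convex in the second variable -/

section Lagrangian

variable {dx dy dh : ℕ}

theorem norm_vpair_sub_left (x x' : Vec dx) (y : Vec dy) : ‖vpair x y - vpair x' y‖ = ‖x - x'‖ := by
  rw [← sq_eq_sq₀ (norm_nonneg _) (norm_nonneg _), WithLp.prod_norm_sq_eq_of_L2]
  simp

theorem norm_vpair_sub_right (x : Vec dx) (y y' : Vec dy) :
    ‖vpair x y - vpair x y'‖ = ‖y - y'‖ := by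
  rw [← sq_eq_sq₀ (norm_nonneg _) (norm_nonneg _), WithLp.prod_norm_sq_eq_of_L2]
  simp

theorem QuadBounds.partial_left {m L : ℝ} {h : VecPair dx dy → ℝ}
    {G : VecPair dx dy → VecPair dx dy} (hq : QuadBounds m L h G) (y : Vec dy) :
    QuadBounds m L (fun x => h (vpair x y)) (fun x => (G (vpair x y)).fst) where
  lower x x' := by
    have := hq.lower (vpair x y) (vpair x' y)
    rw [norm_vpair_sub_left, WithLp.prod_inner_apply] at this
    simpa using this
  upper x x' := by
    have := hq.upper (vpair x y) (vpair x' y)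
    rw [norm_vpair_sub_left, WithLp.prod_inner_apply] at this
    simpa using this

theorem QuadBounds.partial_right {m L : ℝ} {h : VecPair dx dy → ℝ}
    {G : VecPair dx dy → VecPair dx dy} (hq : QuadBounds m L h G) (x : Vec dx) :
    QuadBounds m L (fun y => h (vpair x y)) (fun y => (G (vpair x y)).snd) where
  lower y y' := by
    have := hq.lower (vpair x y) (vpair x y')
    rw [norm_vpair_sub_right, WithLp.prod_inner_apply] at this
    simpa using this
  upper y y' := by
    have := hq.upper (vpair x y) (vpair x y')
    rw [norm_vpair_sub_right, WithLp.prod_inner_apply] at this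
    simpa using this

/-- `h` has `L`-Lipschitz gradient `G` and is `μ`-strongly convex in its second variable. -/
structure SmoothModel (μ L : ℝ) (h : VecPair dx dy → ℝ) (G : VecPair dx dy → VecPair dx dy) :
    Prop where
  quad : QuadBounds (-L) L h G
  lip : ∀ p q, ‖G p - G q‖ ≤ L * ‖p - q‖
  strong : ∀ x, QuadBounds μ L (fun y => h (vpair x y)) (fun y => (G (vpair x y)).snd)

theorem SmoothModel.smoothFamily {μ L : ℝ} {h : VecPair dx dy → ℝ}
    {G : VecPair dx dy → VecPair dx dy} (hm : SmoothModel μ L h G) :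
    SmoothFamily μ L L (fun x y => h (vpair x y)) (fun x y => (G (vpair x y)).fst)
      (fun x y => (G (vpair x y)).snd) where
  quad_left y := hm.quad.partial_left y
  quad_right := hm.strong
  lip_left x y y' := by
    rw [← WithLp.sub_fst, ← norm_vpair_sub_right x]
    exact (WithLp.norm_fst_le _ _).trans (hm.lip _ _)
  lip_right x x' y := by
    rw [← WithLp.sub_snd, ← norm_vpair_sub_left x x' y]
    exact (WithLp.norm_snd_le _ _).trans (hm.lip _ _)

/-! ### Curvature of the augmented Lagrangian -/

/-- The augmented Lagrangian of minimizing `h(x, ·)` over the feasible set. -/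
def lag (h : VecPair dx dy → ℝ) (A : Matrix (Fin dh) (Fin dy) ℝ) (b : Vec dh) (ρ : ℝ) (u : Vec dh)
    (x : Vec dx) (p : VecPair dy dh) : ℝ :=
  h (vpair x p.fst) + inner ℝ u (residual A b p) + ρ / 2 * ‖residual A b p‖ ^ 2

/-- The gradient of `lag` in the pair (variable, slack). -/
def lagGrad (G : VecPair dx dy → VecPair dx dy) (A : Matrix (Fin dh) (Fin dy) ℝ) (b : Vec dh)
    (ρ : ℝ) (u : Vec dh) (x : Vec dx) (p : VecPair dy dh) : VecPair dy dh :=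
  vpair ((G (vpair x p.fst)).snd
      + LinearMap.adjoint (Matrix.toEuclideanLin A) (u + ρ • residual A b p))
    (-(u + ρ • residual A b p))

/-- The operator norm of `A`. -/
def opNorm (A : Matrix (Fin dh) (Fin dy) ℝ) : ℝ :=
  ‖LinearMap.toContinuousLinearMap (Matrix.toEuclideanLin A)‖

/-- The strong convexity modulus of the augmented Lagrangian. -/
def lagModulus (A : Matrix (Fin dh) (Fin dy) ℝ) (μ ρ : ℝ) : ℝ :=
  min (μ / (1 + 2 * opNorm A ^ 2)) (ρ / 2)

/-- The smoothness modulus of the augmented Lagrangian. -/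
def lagSmoothness (A : Matrix (Fin dh) (Fin dy) ℝ) (L ρ : ℝ) : ℝ :=
  L + ρ * (opNorm A + 1) ^ 2

variable {A : Matrix (Fin dh) (Fin dy) ℝ} {b : Vec dh} {μ L ρ : ℝ}
  {h : VecPair dx dy → ℝ} {G : VecPair dx dy → VecPair dx dy}

theorem opNorm_nonneg (A : Matrix (Fin dh) (Fin dy) ℝ) : 0 ≤ opNorm A := norm_nonneg _

theorem norm_toEuclideanLin_le (A : Matrix (Fin dh) (Fin dy) ℝ) (y : Vec dy) :
    ‖Matrix.toEuclideanLin A y‖ ≤ opNorm A * ‖y‖ :=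
  (LinearMap.toContinuousLinearMap (Matrix.toEuclideanLin A)).le_opNorm y

theorem lagModulus_pos (hμ : 0 < μ) (hρ : 0 < ρ) : 0 < lagModulus A μ ρ :=
  lt_min (by positivity) (by positivity)

theorem lagSmoothness_pos (hL : 0 < L) (hρ : 0 < ρ) : 0 < lagSmoothness A L ρ := by
  have := opNorm_nonneg A
  unfold lagSmoothness
  positivity

theorem residual_sub (p q : VecPair dy dh) :
    residual A b q - residual A b p = Matrix.toEuclideanLin A (q - p).fst - (q - p).snd := by
  simp only [residual, WithLp.sub_fst, WithLp.sub_snd, map_sub]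
  abel

theorem norm_residual_sub_le (p q : VecPair dy dh) :
    ‖residual A b q - residual A b p‖ ≤ (opNorm A + 1) * ‖q - p‖ := by
  rw [residual_sub]
  refine (norm_sub_le _ _).trans ?_
  have h1 := norm_toEuclideanLin_le A (q - p).fst
  have h2 := mul_le_mul_of_nonneg_left (WithLp.norm_fst_le _ (q - p)) (opNorm_nonneg A)
  have h3 := WithLp.norm_snd_le _ (q - p)
  linarith

/-- The constraint terms are exactly quadratic, so only the remainder of `h` has to be estimated. -/
theorem lag_expand (u : Vec dh) (x : Vec dx) (p q : VecPair dy dh) :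
    lag h A b ρ u x q = lag h A b ρ u x p + inner ℝ (lagGrad G A b ρ u x p) (q - p)
      + (h (vpair x q.fst) - h (vpair x p.fst)
        - inner ℝ (G (vpair x p.fst)).snd (q.fst - p.fst))
      + ρ / 2 * ‖residual A b q - residual A b p‖ ^ 2 := by
  have e1 : inner ℝ (lagGrad G A b ρ u x p) (q - p) =
      inner ℝ (G (vpair x p.fst)).snd (q.fst - p.fst)
      + inner ℝ (u + ρ • residual A b p) (residual A b q - residual A b p) := by
    rw [WithLp.prod_inner_apply, residual_sub]
    simp only [lagGrad, inner_add_left, LinearMap.adjoint_inner_left, inner_sub_right,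
      inner_neg_left, WithLp.ofLp_fst, WithLp.ofLp_snd, WithLp.sub_fst, WithLp.sub_snd, map_sub]
    ring
  rw [e1, norm_sub_sq_real, real_inner_comm (residual A b p) (residual A b q)]
  simp only [lag, inner_add_left, real_inner_smul_left, inner_sub_right,
    real_inner_self_eq_norm_sq]
  ring

/-- The curvature of `h` covers the variable alone; the penalty supplies the slack direction, since
`‖α‖ ≤ ‖A‖ ‖y‖ + ‖A y - α‖`. -/
theorem SmoothModel.lag_quadBounds (hm : SmoothModel μ L h G) (hμ : 0 < μ) (hL : 0 ≤ L) (hρ : 0 < ρ)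
    (b : Vec dh) (u : Vec dh) (x : Vec dx) :
    QuadBounds (lagModulus A μ ρ) (lagSmoothness A L ρ) (lag h A b ρ u x)
      (lagGrad G A b ρ u x) := by
  constructor
  · intro p q
    rw [lag_expand (G := G) u x p q]
    have h1 := (hm.strong x).lower p.fst q.fst
    suffices lagModulus A μ ρ * ‖q - p‖ ^ 2 ≤
        μ * ‖q.fst - p.fst‖ ^ 2 + ρ * ‖residual A b q - residual A b p‖ ^ 2 by linarith
    rw [residual_sub, WithLp.prod_norm_sq_eq_of_L2, ← WithLp.sub_fst]
    generalize q - p = d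
    have h2 : ‖d.snd‖ ≤ opNorm A * ‖d.fst‖ + ‖Matrix.toEuclideanLin A d.fst - d.snd‖ := by
      have h3 := norm_sub_norm_le d.snd (Matrix.toEuclideanLin A d.fst)
      rw [norm_sub_rev] at h3
      have := norm_toEuclideanLin_le A d.fst
      linarith
    set s := ‖Matrix.toEuclideanLin A d.fst - d.snd‖
    have h3 : ‖d.snd‖ ^ 2 ≤ 2 * opNorm A ^ 2 * ‖d.fst‖ ^ 2 + 2 * s ^ 2 := by
      have := pow_le_pow_left₀ (norm_nonneg _) h2 2
      nlinarith [sq_nonneg (opNorm A * ‖d.fst‖ - s)]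
    have hc := lagModulus_pos (A := A) hμ hρ
    have h4 : lagModulus A μ ρ * (1 + 2 * opNorm A ^ 2) ≤ μ := by
      rw [← le_div_iff₀ (by positivity)]
      exact min_le_left _ _
    have h5 : lagModulus A μ ρ * 2 ≤ ρ := by
      rw [← le_div_iff₀ two_pos]
      exact min_le_right _ _
    have h6 := mul_le_mul_of_nonneg_right h4 (sq_nonneg ‖d.fst‖)
    have h7 := mul_le_mul_of_nonneg_right h5 (sq_nonneg s)
    have h8 := mul_le_mul_of_nonneg_left h3 hc.le
    linarith
  · intro p q
    rw [lag_expand (G := G) u x p q]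
    have h1 := (hm.strong x).upper p.fst q.fst
    have h2 := pow_le_pow_left₀ (norm_nonneg _) (norm_residual_sub_le (A := A) (b := b) p q) 2
    have h3 : L / 2 * ‖q.fst - p.fst‖ ^ 2 ≤ L / 2 * ‖q - p‖ ^ 2 := by
      rw [← WithLp.sub_fst]
      gcongr
      exact WithLp.norm_fst_le _ _
    rw [mul_pow] at h2
    have h4 := mul_le_mul_of_nonneg_left h2 hρ.le
    unfold lagSmoothness
    linarith

theorem SmoothModel.lag_smoothFamily (hm : SmoothModel μ L h G) (hμ : 0 < μ) (hL : 0 ≤ L)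
    (hρ : 0 < ρ) (b : Vec dh) (u : Vec dh) :
    SmoothFamily (lagModulus A μ ρ) L (lagSmoothness A L ρ) (lag h A b ρ u)
      (fun x p => (G (vpair x p.fst)).fst) (lagGrad G A b ρ u) where
  quad_left p := by
    have := (hm.quad.partial_left p.fst).add_const
      (inner ℝ u (residual A b p) + ρ / 2 * ‖residual A b p‖ ^ 2)
    simpa only [lag, add_assoc] using this
  quad_right := hm.lag_quadBounds hμ hL hρ b u
  lip_left x p p' := by
    refine (hm.smoothFamily.lip_left x p.fst p'.fst).trans ?_
    rw [← WithLp.sub_fst]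
    gcongr
    exact WithLp.norm_fst_le _ _
  lip_right x x' p := by
    refine le_trans (le_of_eq ?_) (hm.smoothFamily.lip_right x x' p.fst)
    rw [← sq_eq_sq₀ (norm_nonneg _) (norm_nonneg _), WithLp.prod_norm_sq_eq_of_L2]
    simp [lagGrad]

theorem convex_slackDomain : Convex ℝ (slackDomain dy dh) := by
  intro x hx y hy s t hs ht _ i
  have h1 := mul_le_mul_of_nonneg_left (hx i) hs
  have h2 := mul_le_mul_of_nonneg_left (hy i) ht
  simp only [WithLp.add_snd, WithLp.smul_snd, PiLp.add_apply, PiLp.smul_apply, smul_eq_mul]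
  linarith

theorem isClosed_slackDomain : IsClosed (slackDomain dy dh) := by
  have : slackDomain dy dh = ⋂ i, {w | w.snd i ≤ 0} := by
    ext
    simp [slackDomain]
  rw [this]
  refine isClosed_iInter fun i => isClosed_le ?_ continuous_const
  have : Continuous fun w : VecPair dy dh => w.snd := WithLp.continuous_snd _ _ _
  fun_prop

theorem zero_mem_slackDomain : (0 : VecPair dy dh) ∈ slackDomain dy dh := fun _ => le_rfl

theorem projSlack_inner_le (w q : VecPair dy dh) (hq : q ∈ slackDomain dy dh) :
    inner ℝ (w - projSlack w) (q - projSlack w) ≤ 0 := by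
  rw [WithLp.prod_inner_apply]
  have h1 : (w - projSlack w).fst = 0 := by simp [projSlack]
  have h2 : inner ℝ (w - projSlack w).snd (q - projSlack w).snd ≤ 0 := by
    rw [PiLp.inner_apply]
    apply Finset.sum_nonpos
    intro i _
    have hqi := hq i
    simp only [projSlack, WithLp.sub_snd, PiLp.sub_apply, WithLp.toLp_snd, RCLike.inner_apply,
      conj_trivial]
    rcases le_total (w.snd i) 0 with h | h
    · simp [min_eq_left h]
    · rw [min_eq_right h]
      nlinarith
  simp only [WithLp.ofLp_fst, WithLp.ofLp_snd, h1, inner_zero_left]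
  linarith

/-! ### The merit function -/

/-- `q(x, u)` minimizes the augmented Lagrangian and `ys(x)` minimizes `h(x, ·)` over the feasible
set. -/
structure Solutions (μ L ρ : ℝ) (A : Matrix (Fin dh) (Fin dy) ℝ) (b : Vec dh)
    (h : VecPair dx dy → ℝ) (G : VecPair dx dy → VecPair dx dy)
    (q : Vec dx → Vec dh → VecPair dy dh) (ys : Vec dx → Vec dy) : Prop where
  model : SmoothModel μ L h G
  q_mem : ∀ x u, q x u ∈ slackDomain dy dh
  q_min : ∀ x u, IsMinOn (lag h A b ρ u x) (slackDomain dy dh) (q x u)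
  ys_mem : ∀ x, ys x ∈ feasibleSet A b
  ys_min : ∀ x, IsMinOn (fun y => h (vpair x y)) (feasibleSet A b) (ys x)

/-- The sum of the primal gap `lag(p) - lag(q(x, u))` and the dual gap `h(ys(x)) - lag(q(x, u))`. -/
def merit (h : VecPair dx dy → ℝ) (A : Matrix (Fin dh) (Fin dy) ℝ) (b : Vec dh) (ρ : ℝ)
    (q : Vec dx → Vec dh → VecPair dy dh) (ys : Vec dx → Vec dy) (x : Vec dx) (p : VecPair dy dh)
    (u : Vec dh) : ℝ :=
  lag h A b ρ u x p - 2 * lag h A b ρ u x (q x u) + h (vpair x (ys x))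

variable {q : Vec dx → Vec dh → VecPair dy dh} {ys : Vec dx → Vec dy}

/-- Weak duality: with slack `A y - b` the residual vanishes and the Lagrangian equals `h`. -/
theorem Solutions.lag_le (S : Solutions μ L ρ A b h G q ys) (x : Vec dx) (u : Vec dh) :
    lag h A b ρ u x (q x u) ≤ h (vpair x (ys x)) := by
  have hres : residual A b (vpair (ys x) (Matrix.toEuclideanLin A (ys x) - b)) = 0 := by
    simp [residual]
  have : lag h A b ρ u x (q x u) ≤
      lag h A b ρ u x (vpair (ys x) (Matrix.toEuclideanLin A (ys x) - b)) :=
    S.q_min x u (S.ys_mem x)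
  simpa [lag, hres] using this

theorem Solutions.merit_nonneg (S : Solutions μ L ρ A b h G q ys) (x : Vec dx) {p : VecPair dy dh}
    (hp : p ∈ slackDomain dy dh) (u : Vec dh) : 0 ≤ merit h A b ρ q ys x p u := by
  have h1 : lag h A b ρ u x (q x u) ≤ lag h A b ρ u x p := S.q_min x u hp
  have h2 := S.lag_le x u
  unfold merit
  linarith

/-- The distance of the Lagrangian minimizer to the constrained minimizer is controlled by the
residual. -/
theorem exists_error_bound (A : Matrix (Fin dh) (Fin dy) ℝ) {μ L : ℝ} (hμ : 0 < μ) (hL : 0 < L) :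
    ∃ σ : ℝ, 0 < σ ∧ ∀ (dx : ℕ) (ρ : ℝ) (b : Vec dh) (h : VecPair dx dy → ℝ)
      (G : VecPair dx dy → VecPair dx dy) (q : Vec dx → Vec dh → VecPair dy dh)
      (ys : Vec dx → Vec dy), Solutions μ L ρ A b h G q ys →
      ∀ x u, ‖(q x u).fst - ys x‖ ≤ σ * ‖residual A b (q x u)‖ := by
  obtain ⟨H, hH0, hH⟩ := exists_argmin_lipschitz_rhs A
  refine ⟨H * L / μ, by positivity, fun dx ρ b h G q ys S x u => ?_⟩
  -- Among points with the same residual the multiplier and penalty terms are constant, so `(q x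
  -- u).fst` minimizes `h(x, ·)` over the feasible set with right-hand side `b + residual`.
  have := hH μ L L (fun y => h (vpair x y)) (fun y => (G (vpair x y)).snd) b
    (b + residual A b (q x u)) (ys x) (q x u).fst hμ hL.le (S.model.strong x)
    (fun y y' => by
      rw [← WithLp.sub_snd, ← norm_vpair_sub_right x]
      exact (WithLp.norm_snd_le _ _).trans (S.model.lip _ _))
    (S.ys_mem x) (S.ys_min x)
    (fun i => by
      have := S.q_mem x u i
      have e : Matrix.toEuclideanLin A (q x u).fst - (b + residual A b (q x u)) = (q x u).snd := by
        simp only [residual]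
        abel
      rwa [e])
    (fun y hy => by
      set p : VecPair dy dh :=
        vpair y (Matrix.toEuclideanLin A y - (b + residual A b (q x u))) with hp
      have hres : residual A b p = residual A b (q x u) := by
        simp only [hp, residual, WithLp.toLp_fst, WithLp.toLp_snd]
        abel
      have h1 : lag h A b ρ u x (q x u) ≤ lag h A b ρ u x p := S.q_min x u hy
      simp only [lag, hres] at h1
      simp only [Set.mem_ofPred_eq]
      have e : p.fst = y := rfl
      rw [e] at h1
      linarith)
  rwa [add_sub_cancel_left] at this

theorem young_ineq {a c t : ℝ} (ht : 0 < t) : a * c ≤ t * a ^ 2 + c ^ 2 / (4 * t) := by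
  rw [← sub_nonneg]
  have : t * a ^ 2 + c ^ 2 / (4 * t) - a * c = (2 * t * a - c) ^ 2 / (4 * t) := by
    field_simp
    ring
  rw [this]
  positivity

/-- Decrease of the merit function along a multiplier step followed by a projected gradient step,
up to the displacement of `x`. -/
theorem exists_merit_decrease (A : Matrix (Fin dh) (Fin dy) ℝ) {μ L ρ : ℝ} (hμ : 0 < μ)
    (hL : 0 < L) (hρ : 0 < ρ) :
    ∃ ηp ηu κ C : ℝ, 0 < ηp ∧ 0 < ηu ∧ 0 < κ ∧ 0 ≤ C ∧
      ∀ (dx : ℕ) (b : Vec dh) (h : VecPair dx dy → ℝ)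
      (G : VecPair dx dy → VecPair dx dy) (q : Vec dx → Vec dh → VecPair dy dh)
      (ys : Vec dx → Vec dy), Solutions μ L ρ A b h G q ys →
      ∀ (x x₁ : Vec dx) (p p₁ : VecPair dy dh) (u u₁ : Vec dh), p ∈ slackDomain dy dh →
        u₁ = u + ηu • residual A b p → p₁ = projSlack (p - ηp • lagGrad G A b ρ u₁ x p) →
        merit h A b ρ q ys x₁ p₁ u₁ ≤
          merit h A b ρ q ys x p u - κ * ‖p.fst - ys x‖ ^ 2 + C * ‖x₁ - x‖ ^ 2 := by
  obtain ⟨σ, hσ0, hσ⟩ := exists_error_bound A hμ hL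
  set m := lagModulus A μ ρ with hm_def
  set L' := lagSmoothness A L ρ with hL'_def
  have hm : 0 < m := lagModulus_pos hμ hρ
  have hL' : 0 < L' := lagSmoothness_pos hL hρ
  set a := opNorm A + 1 with ha_def
  have ha : 0 < a := by
    have := opNorm_nonneg A
    positivity
  set ηp := 1 / L' with hηp_def
  have hηp : 0 < ηp := by positivity
  set θ := ηp * m ^ 2 / 8 with hθ_def
  have hθ : 0 < θ := by positivity
  -- The multiplier step may then cost at most half of the gain `θ e²`. Of the rest, `θ/4 e²` and
  -- `ηu/2 s²` pay for the cross terms with `D`, and `κ` is what the remainder can still afford.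
  set ηu := θ / (2 * a ^ 2) with hηu_def
  have hηu : 0 < ηu := by positivity
  set κ := min (θ / 8) (ηu / (4 * σ ^ 2)) with hκ_def
  have hκ : 0 < κ := by positivity
  -- Curvatures in `x` of the three terms of `merit`; the middle one is doubled by the weight `2`.
  set C₀ := L / 2 + (L + 2 * L ^ 2 / m) + L / 2 with hC₀
  refine ⟨ηp, ηu, κ, C₀ + L ^ 2 / θ + (L * σ) ^ 2 / (2 * ηu), hηp, hηu, hκ, by positivity, ?_⟩
  intro dx b h G q ys S x x₁ p p₁ u u₁ hp hu₁ hp₁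
  set r := q x u₁ with hr_def
  set e := ‖p - r‖ with he_def
  set s := ‖residual A b r‖ with hs_def
  set D := ‖x₁ - x‖ with hD_def
  have he0 : 0 ≤ e := norm_nonneg _
  have hs0 : 0 ≤ s := norm_nonneg _
  have hD0 : 0 ≤ D := norm_nonneg _
  have hp₁mem : p₁ ∈ slackDomain dy dh := hp₁ ▸ projSlack_mem _
  -- multiplier step
  have step1 : merit h A b ρ q ys x p u₁ ≤
      merit h A b ρ q ys x p u + ηu * (a * e) ^ 2 - ηu * s ^ 2 := by
    have h1 : lag h A b ρ u x (q x u) ≤ lag h A b ρ u x r := S.q_min x u (S.q_mem x u₁)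
    have h2 : ‖residual A b p - residual A b r‖ ^ 2 ≤ (a * e) ^ 2 :=
      pow_le_pow_left₀ (norm_nonneg _) (norm_residual_sub_le r p) 2
    have e1 : lag h A b ρ u₁ x p = lag h A b ρ u x p + ηu * ‖residual A b p‖ ^ 2 := by
      simp only [lag, hu₁, inner_add_left, real_inner_smul_left, real_inner_self_eq_norm_sq]
      ring
    have e2 : lag h A b ρ u₁ x r =
        lag h A b ρ u x r + ηu * inner ℝ (residual A b p) (residual A b r) := by
      simp only [lag, hu₁, inner_add_left, real_inner_smul_left]
      ring
    -- The weight `2` on the dual value completes the square: the change is at most `ηu (‖res p -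
    -- res r‖² - ‖res r‖²)`.
    rw [norm_sub_sq_real] at h2
    have h3 := mul_le_mul_of_nonneg_left h2 hηu.le
    unfold merit
    rw [e1, ← hr_def, e2]
    linarith
  -- projected gradient step
  obtain ⟨hdec, hnear⟩ := (S.model.lag_quadBounds hμ hL.le hρ b u₁ x).projected_gradient hm hηp
    (by rw [hηp_def, one_div, inv_mul_cancel₀ hL'.ne']) hp hp₁mem
    (fun w hw => by rw [hp₁]; exact projSlack_inner_le _ _ hw) (S.q_mem x u₁) (S.q_min x u₁)
  rw [← hm_def, ← hr_def, ← he_def, ← hθ_def] at hdec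
  have step2 : merit h A b ρ q ys x p₁ u₁ ≤ merit h A b ρ q ys x p u₁ - θ * e ^ 2 := by
    unfold merit
    linarith
  -- displacement of `x`
  have hfam := S.model.lag_smoothFamily (A := A) hμ hL.le hρ b u₁
  rw [← hm_def] at hfam
  have hx1 := (hfam.quad_left p₁).upper x x₁
  have hx2 := (hfam.marginal hm hL.le convex_slackDomain (fun x => S.q_mem x u₁)
    (fun x => S.q_min x u₁)).lower x x₁
  have hx3 := (S.model.smoothFamily.marginal hμ hL.le (convex_feasibleSet A b) S.ys_mem
    S.ys_min).upper x x₁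
  -- The weight `2` also splits the `x`-gradient of `merit` into two differences, small with `e` and
  -- with `s` respectively.
  have hg1 : inner ℝ ((G (vpair x p₁.fst)).fst - (G (vpair x r.fst)).fst) (x₁ - x) ≤
      L * e * D := by
    refine (real_inner_le_norm _ _).trans ?_
    gcongr
    exact (hfam.lip_left x p₁ r).trans (by gcongr)
  have hg2 : inner ℝ ((G (vpair x (ys x))).fst - (G (vpair x r.fst)).fst) (x₁ - x) ≤
      L * (σ * s) * D := by
    refine (real_inner_le_norm _ _).trans ?_
    gcongr
    refine (S.model.smoothFamily.lip_left x (ys x) r.fst).trans ?_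
    gcongr
    rw [norm_sub_rev]
    exact hσ dx ρ b h G q ys S x u₁
  rw [inner_sub_left] at hg1 hg2
  have step3 : merit h A b ρ q ys x₁ p₁ u₁ ≤
      merit h A b ρ q ys x p₁ u₁ + L * e * D + L * (σ * s) * D + C₀ * D ^ 2 := by
    unfold merit
    simp only [← hr_def, ← hD_def] at hx1 hx2 hx3 ⊢
    rw [hC₀]
    linarith
  -- combination
  have hy1 : e * (L * D) ≤ θ / 4 * e ^ 2 + L ^ 2 / θ * D ^ 2 := by
    refine (young_ineq (a := e) (c := L * D) (t := θ / 4) (by positivity)).trans (le_of_eq ?_)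
    field_simp
  have hy2 : s * (L * σ * D) ≤ ηu / 2 * s ^ 2 + (L * σ) ^ 2 / (2 * ηu) * D ^ 2 := by
    refine (young_ineq (a := s) (c := L * σ * D) (t := ηu / 2) (by positivity)).trans (le_of_eq ?_)
    field_simp
    ring
  have hηa : ηu * (a * e) ^ 2 = θ / 2 * e ^ 2 := by
    rw [hηu_def]
    field_simp
  have hdist : ‖p.fst - ys x‖ ≤ e + σ * s := by
    have h1 := norm_sub_le_norm_sub_add_norm_sub p.fst r.fst (ys x)
    have h2 := hσ dx ρ b h G q ys S x u₁
    have h3 : ‖p.fst - r.fst‖ ≤ e := by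
      rw [← WithLp.sub_fst]
      exact WithLp.norm_fst_le _ _
    linarith
  have hdist2 : ‖p.fst - ys x‖ ^ 2 ≤ 2 * e ^ 2 + 2 * σ ^ 2 * s ^ 2 := by
    refine (pow_le_pow_left₀ (norm_nonneg _) hdist 2).trans ?_
    rw [← sub_nonneg, show 2 * e ^ 2 + 2 * σ ^ 2 * s ^ 2 - (e + σ * s) ^ 2 = (e - σ * s) ^ 2 by ring]
    exact sq_nonneg _
  have hκ1 : κ * (2 * e ^ 2) ≤ θ / 4 * e ^ 2 := by
    calc κ * (2 * e ^ 2) ≤ θ / 8 * (2 * e ^ 2) := by gcongr; exact min_le_left _ _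
      _ = θ / 4 * e ^ 2 := by ring
  have hκ2 : κ * (2 * σ ^ 2 * s ^ 2) ≤ ηu / 2 * s ^ 2 := by
    calc κ * (2 * σ ^ 2 * s ^ 2) ≤ ηu / (4 * σ ^ 2) * (2 * σ ^ 2 * s ^ 2) := by
          gcongr; exact min_le_right _ _
      _ = ηu / 2 * s ^ 2 := by field_simp; ring
  have hκ3 := mul_le_mul_of_nonneg_left hdist2 hκ.le
  linarith

/-- A bound on the merit function for an arbitrary point. -/
theorem Solutions.merit_le (S : Solutions μ L ρ A b h G q ys) (hμ : 0 < μ) (hL : 0 ≤ L) (hρ : 0 < ρ)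
    (x : Vec dx) (p : VecPair dy dh) (u : Vec dh) {y : Vec dy} (hy : y ∈ feasibleSet A b) :
    merit h A b ρ q ys x p u ≤ h (vpair x y) - lag h A b ρ u x p
      + ‖lagGrad G A b ρ u x p‖ ^ 2 / lagModulus A μ ρ := by
  have hm := lagModulus_pos (A := A) hμ hρ
  have h1 := (S.model.lag_quadBounds (A := A) hμ hL hρ b u x).lower p (q x u)
  have h2 : h (vpair x (ys x)) ≤ h (vpair x y) := S.ys_min x hy
  have h3 := neg_le_of_abs_le (abs_real_inner_le_norm (lagGrad G A b ρ u x p) (q x u - p))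
  have h4 := young_ineq (a := ‖q x u - p‖) (c := ‖lagGrad G A b ρ u x p‖)
    (t := lagModulus A μ ρ / 2) (by positivity)
  have e : ‖lagGrad G A b ρ u x p‖ ^ 2 / (4 * (lagModulus A μ ρ / 2)) =
      ‖lagGrad G A b ρ u x p‖ ^ 2 / lagModulus A μ ρ / 2 := by
    field_simp
    ring
  rw [e] at h4
  unfold merit
  linarith

/-- A bound on the merit function for points close to the solution. -/
theorem Solutions.merit_le_of_close (S : Solutions μ L ρ A b h G q ys) (hμ : 0 < μ) (hL : 0 ≤ L)
    (hρ : 0 < ρ) {σ r N : ℝ} (x : Vec dx) (p : VecPair dy dh) (u : Vec dh)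
    (hσ : ‖(q x u).fst - ys x‖ ≤ σ * ‖residual A b (q x u)‖) (hσ0 : 0 ≤ σ)
    (hN : ‖(G (vpair x (ys x))).snd‖ ≤ N) (hy : ‖p.fst - ys x‖ ≤ r)
    (hq : ‖residual A b (q x u)‖ ≤ r) (hp : ‖residual A b p‖ ≤ r) :
    merit h A b ρ q ys x p u ≤ r * (N + 2 * (N * σ) + 3 * ‖u‖ + (L + ρ) / 2 * r) := by
  have hN0 : 0 ≤ N := (norm_nonneg _).trans hN
  have hr0 : 0 ≤ r := (norm_nonneg _).trans hy
  -- Expanding `h` around `ys x` cancels its values there, leaving only terms of first and second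
  -- order in `r`.
  have h1 := (S.model.strong x).lower (ys x) (q x u).fst
  have h2 := (S.model.strong x).upper (ys x) p.fst
  have h3 := neg_le_of_abs_le
    (abs_real_inner_le_norm (G (vpair x (ys x))).snd ((q x u).fst - ys x))
  have h4 := real_inner_le_norm (G (vpair x (ys x))).snd (p.fst - ys x)
  have h5 : ‖(G (vpair x (ys x))).snd‖ * ‖(q x u).fst - ys x‖ ≤ N * (σ * r) := by
    gcongr
    exact hσ.trans (by gcongr)
  have h6 : ‖(G (vpair x (ys x))).snd‖ * ‖p.fst - ys x‖ ≤ N * r := by gcongr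
  have h7 : L / 2 * ‖p.fst - ys x‖ ^ 2 ≤ L / 2 * r ^ 2 := by gcongr
  have h8 := neg_le_of_abs_le (abs_real_inner_le_norm u (residual A b (q x u)))
  have h9 := real_inner_le_norm u (residual A b p)
  have h10 : ‖u‖ * ‖residual A b (q x u)‖ ≤ ‖u‖ * r := by gcongr
  have h11 : ‖u‖ * ‖residual A b p‖ ≤ ‖u‖ * r := by gcongr
  have h12 : ρ / 2 * ‖residual A b p‖ ^ 2 ≤ ρ / 2 * r ^ 2 := by gcongr
  have h13 : 0 ≤ ρ / 2 * ‖residual A b (q x u)‖ ^ 2 := by positivity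
  have h14 : 0 ≤ μ / 2 * ‖(q x u).fst - ys x‖ ^ 2 := by positivity
  unfold merit lag
  linarith

end Lagrangian

/-! ### The bilevel problem -/

section Bilevel

theorem QuadBounds.of_strongConvexOn {X : Type*} [NormedAddCommGroup X] [InnerProductSpace ℝ X]
    {m L μ : ℝ} {φ : X → ℝ} {M : X → X} (h : QuadBounds m L φ M)
    (hs : StrongConvexOn Set.univ μ φ) : QuadBounds μ L φ M where
  upper := h.upper
  lower p q := by
    suffices 0 ≤ φ q - φ p - inner ℝ (M p) (q - p) - μ / 2 * ‖q - p‖ ^ 2 by linarith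
    apply nonneg_of_forall_add_mul_nonneg (c := (μ / 2 - m / 2) * ‖q - p‖ ^ 2)
    intro t ht ht1
    have h1 := hs.2 (Set.mem_univ p) (Set.mem_univ q) (sub_nonneg.2 ht1) ht.le
      (sub_add_cancel 1 t)
    have h2 := h.lower p (p + t • (q - p))
    have e : (1 - t) • p + t • q = p + t • (q - p) := by
      rw [sub_smul, one_smul, smul_sub]
      abel
    rw [add_sub_cancel_left, real_inner_smul_right, norm_smul, Real.norm_eq_abs, abs_of_pos ht]
      at h2
    simp only [e, smul_eq_mul] at h1
    rw [norm_sub_rev p q] at h1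
    refine nonneg_of_mul_nonneg_right (?_ : 0 ≤ t * _) ht
    linarith

variable {dx dy dh : ℕ}

/-- The penalized lower-level objective `δ f + g`. -/
def penalized (f g : VecPair dx dy → ℝ) (δ : ℝ) (p : VecPair dx dy) : ℝ := δ * f p + g p

/-- The gradient of `penalized`. -/
def penalizedGrad (f g : VecPair dx dy → ℝ) (δ : ℝ) (p : VecPair dx dy) : VecPair dx dy :=
  δ • gradient f p + gradient g p

/-- The difference of the two lower-level optimal values, equal to `δ Φ_δ`. -/
def valueGap (f g : VecPair dx dy → ℝ) (A : Matrix (Fin dh) (Fin dy) ℝ) (b : Vec dh) (δ : ℝ)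
    (x : Vec dx) : ℝ :=
  penalized f g δ (vpair x (yStar f g A b δ x)) - g (vpair x (zStar g A b x))

/-- The gradient of `valueGap`. -/
def valueGapGrad (f g : VecPair dx dy → ℝ) (A : Matrix (Fin dh) (Fin dy) ℝ) (b : Vec dh) (δ : ℝ)
    (x : Vec dx) : Vec dx :=
  (penalizedGrad f g δ (vpair x (yStar f g A b δ x))).fst
    - (gradient g (vpair x (zStar g A b x))).fst

/-- The potential of the algorithm. -/
def potential (f g : VecPair dx dy → ℝ) (A : Matrix (Fin dh) (Fin dy) ℝ) (b : Vec dh)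
    (δ ρ₁ ρ₂ : ℝ) (s : State dx dy dh) : ℝ :=
  merit (penalized f g δ) A b ρ₁ (yAugStar f g A b δ ρ₁ ρ₂) (yStar f g A b δ) s.x s.y' s.u
    + merit g A b ρ₂ (zAugStar f g A b δ ρ₁ ρ₂) (zStar g A b) s.x s.z' s.v
    + valueGap f g A b δ s.x

variable {A : Matrix (Fin dh) (Fin dy) ℝ} {b : Vec dh} {f g : VecPair dx dy → ℝ}
  {lf0 lf1 lg1 : ℝ≥0} {μg δ ρ₁ ρ₂ : ℝ}

theorem augLag_eq (x : Vec dx) (y' z' : VecPair dy dh) (u v : Vec dh) :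
    augLag f g A b δ ρ₁ ρ₂ x y' z' u v =
      lag (penalized f g δ) A b ρ₁ u x y' - lag g A b ρ₂ v x z' := by
  unfold augLag lag penalized
  ring

theorem Assumptions.quad_f (h : Assumptions f g A b lf0 lf1 lg1 μg) :
    QuadBounds (-lf1 : ℝ) lf1 f (gradient f) :=
  .of_lipschitz_gradient (h.contDiff_f.differentiable one_ne_zero) h.lipschitz_grad_f

theorem Assumptions.quad_g (h : Assumptions f g A b lf0 lf1 lg1 μg) :
    QuadBounds (-lg1 : ℝ) lg1 g (gradient g) :=
  .of_lipschitz_gradient (h.contDiff_g.differentiable one_ne_zero) h.lipschitz_grad_g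

/-- The perturbation `δ f` uses up at most half of the convexity of `g`, which leaves moduli free of
`δ`. -/
theorem Assumptions.smoothModel_penalized (h : Assumptions f g A b lf0 lf1 lg1 μg) (hδ : 0 ≤ δ)
    (hδ' : 2 * (lf1 : ℝ) * δ ≤ μg) :
    SmoothModel (μg / 2) (lg1 + μg / 2) (penalized f g δ) (penalizedGrad f g δ) where
  quad := ((h.quad_f.const_mul hδ).add h.quad_g).mono (by linarith) (by linarith)
  lip p q := by
    have h1 := h.lipschitz_grad_f.norm_sub_le p q
    have h2 := h.lipschitz_grad_g.norm_sub_le p q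
    have e : penalizedGrad f g δ p - penalizedGrad f g δ q =
        δ • (gradient f p - gradient f q) + (gradient g p - gradient g q) := by
      rw [penalizedGrad, penalizedGrad, smul_sub]
      abel
    rw [e]
    refine (norm_add_le _ _).trans ?_
    rw [norm_smul, Real.norm_eq_abs, abs_of_nonneg hδ]
    have h3 := mul_le_mul_of_nonneg_left h1 hδ
    have h4 : (δ * lf1) * ‖p - q‖ ≤ μg / 2 * ‖p - q‖ := by
      gcongr
      linarith
    linarith
  strong x :=
    (((h.quad_f.partial_right x).const_mul hδ).add
      ((h.quad_g.partial_right x).of_strongConvexOn (h.strongConvex_g x))).mono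
      (by linarith) (by linarith)

theorem Assumptions.smoothModel (h : Assumptions f g A b lf0 lf1 lg1 μg) (hμ : 0 < μg) :
    SmoothModel (μg / 2) (lg1 + μg / 2) g (gradient g) := by
  have := h.smoothModel_penalized le_rfl (by simpa using hμ.le)
  have e1 : penalized f g 0 = g := by
    ext
    simp [penalized]
  have e2 : penalizedGrad f g 0 = gradient g := by
    ext1
    simp [penalizedGrad]
  rwa [e1, e2] at this

theorem Assumptions.solutions_y (h : Assumptions f g A b lf0 lf1 lg1 μg) (hμ : 0 < μg)
    (hδ : 0 ≤ δ) (hδ' : 2 * (lf1 : ℝ) * δ ≤ μg) (hρ₁ : 0 < ρ₁) (ρ₂ : ℝ) :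
    Solutions (μg / 2) (lg1 + μg / 2) ρ₁ A b (penalized f g δ) (penalizedGrad f g δ)
      (yAugStar f g A b δ ρ₁ ρ₂) (yStar f g A b δ) := by
  have hm := h.smoothModel_penalized hδ hδ'
  have hμ2 : 0 < μg / 2 := by positivity
  have h1 : ∀ (x : Vec dx) (u : Vec dh), yAugStar f g A b δ ρ₁ ρ₂ x u ∈ slackDomain dy dh ∧
      IsMinOn (lag (penalized f g δ) A b ρ₁ u x) (slackDomain dy dh)
        (yAugStar f g A b δ ρ₁ ρ₂ x u) := by
    intro x u
    have hq := hm.lag_quadBounds (A := A) hμ2 (by positivity) hρ₁ b u x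
    have := argminOn_spec ((hq.add_const (-lag g A b ρ₂ 0 x 0)).exists_isMinOn
      (lagModulus_pos hμ2 hρ₁) isClosed_slackDomain ⟨0, zero_mem_slackDomain⟩)
    have e : argminOn (slackDomain dy dh)
        (fun p => lag (penalized f g δ) A b ρ₁ u x p + -lag g A b ρ₂ 0 x 0) =
        yAugStar f g A b δ ρ₁ ρ₂ x u := by
      simp only [yAugStar, augLag_eq, sub_eq_add_neg]
    rw [e] at this
    refine ⟨this.1, isMinOn_iff.2 fun p hp => ?_⟩
    exact le_of_add_le_add_right (isMinOn_iff.1 this.2 p hp)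
  have h2 : ∀ x, yStar f g A b δ x ∈ feasibleSet A b ∧
      IsMinOn (fun y => penalized f g δ (vpair x y)) (feasibleSet A b) (yStar f g A b δ x) :=
    fun x => argminOn_spec
      ((hm.strong x).exists_isMinOn hμ2 (isClosed_feasibleSet A b) h.feasible_nonempty)
  exact ⟨hm, fun x u => (h1 x u).1, fun x u => (h1 x u).2, fun x => (h2 x).1, fun x => (h2 x).2⟩

theorem Assumptions.solutions_z (h : Assumptions f g A b lf0 lf1 lg1 μg) (hμ : 0 < μg)
    (δ ρ₁ : ℝ) (hρ₂ : 0 < ρ₂) :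
    Solutions (μg / 2) (lg1 + μg / 2) ρ₂ A b g (gradient g)
      (zAugStar f g A b δ ρ₁ ρ₂) (zStar g A b) := by
  have hm := h.smoothModel hμ
  have hμ2 : 0 < μg / 2 := by positivity
  have h1 : ∀ (x : Vec dx) (v : Vec dh), zAugStar f g A b δ ρ₁ ρ₂ x v ∈ slackDomain dy dh ∧
      IsMinOn (lag g A b ρ₂ v x) (slackDomain dy dh) (zAugStar f g A b δ ρ₁ ρ₂ x v) := by
    intro x v
    have hq := hm.lag_quadBounds (A := A) hμ2 (by positivity) hρ₂ b v x
    have := argminOn_spec ((hq.add_const (-lag (penalized f g δ) A b ρ₁ 0 x 0)).exists_isMinOn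
      (lagModulus_pos hμ2 hρ₂) isClosed_slackDomain ⟨0, zero_mem_slackDomain⟩)
    have e : argminOn (slackDomain dy dh)
        (fun p => lag g A b ρ₂ v x p + -lag (penalized f g δ) A b ρ₁ 0 x 0) =
        zAugStar f g A b δ ρ₁ ρ₂ x v := by
      simp only [zAugStar, augLag_eq, neg_sub]
      simp only [sub_eq_add_neg]
    rw [e] at this
    refine ⟨this.1, isMinOn_iff.2 fun p hp => ?_⟩
    exact le_of_add_le_add_right (isMinOn_iff.1 this.2 p hp)
  have h2 : ∀ x, zStar g A b x ∈ feasibleSet A b ∧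
      IsMinOn (fun y => g (vpair x y)) (feasibleSet A b) (zStar g A b x) :=
    fun x => argminOn_spec
      ((hm.strong x).exists_isMinOn hμ2 (isClosed_feasibleSet A b) h.feasible_nonempty)
  exact ⟨hm, fun x u => (h1 x u).1, fun x u => (h1 x u).2, fun x => (h2 x).1, fun x => (h2 x).2⟩

theorem Solutions.marginal {μ L ρ : ℝ} {h : VecPair dx dy → ℝ}
    {G : VecPair dx dy → VecPair dx dy} {q : Vec dx → Vec dh → VecPair dy dh}
    {ys : Vec dx → Vec dy} (S : Solutions μ L ρ A b h G q ys) (hμ : 0 < μ) (hL : 0 ≤ L) :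
    QuadBounds (-(L + 2 * L ^ 2 / μ)) L (fun x => h (vpair x (ys x)))
      (fun x => (G (vpair x (ys x))).fst) :=
  S.model.smoothFamily.marginal hμ hL (convex_feasibleSet A b) S.ys_mem S.ys_min

theorem Assumptions.quad_valueGap (h : Assumptions f g A b lf0 lf1 lg1 μg) (hμ : 0 < μg)
    (hδ : 0 ≤ δ) (hδ' : 2 * (lf1 : ℝ) * δ ≤ μg) {L : ℝ} (hL : L = lg1 + μg / 2) :
    QuadBounds (-(L + 2 * L ^ 2 / (μg / 2)) - L) (L + (L + 2 * L ^ 2 / (μg / 2)))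
      (valueGap f g A b δ) (valueGapGrad f g A b δ) := by
  subst hL
  -- The penalty parameters do not enter the constrained value functions and are set to `1`.
  have h1 := (h.solutions_y hμ hδ hδ' one_pos 1).marginal (by positivity) (by positivity)
  have h2 := (h.solutions_z hμ δ 1 one_pos).marginal (by positivity) (by positivity)
  have := h1.sub h2
  rwa [sub_neg_eq_add] at this

/-- The penalty reformulation in terms of the two lower-level optimal values. -/
theorem Assumptions.penaltyObj_eq (h : Assumptions f g A b lf0 lf1 lg1 μg) (hμ : 0 < μg)
    (hδ : 0 < δ) (hδ' : 2 * (lf1 : ℝ) * δ ≤ μg) :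
    penaltyObj f g A b δ = fun x => 1 / δ * valueGap f g A b δ x := by
  ext x
  have hy := h.solutions_y hμ hδ.le hδ' one_pos 1
  have hz := h.solutions_z hμ δ 1 one_pos
  have hne : Nonempty (feasibleSet A b) := h.feasible_nonempty.to_subtype
  have hsup : ∀ y : feasibleSet A b, (⨆ z : feasibleSet A b,
      f (vpair x y.1) + 1 / δ * (g (vpair x y.1) - g (vpair x z.1))) =
      1 / δ * (penalized f g δ (vpair x y.1) - g (vpair x (zStar g A b x))) := by
    intro y
    have e : 1 / δ * (penalized f g δ (vpair x y.1) - g (vpair x (zStar g A b x))) =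
        f (vpair x y.1) + 1 / δ * (g (vpair x y.1) - g (vpair x (zStar g A b x))) := by
      unfold penalized
      field_simp
      ring
    rw [e]
    have hle : ∀ z : feasibleSet A b,
        f (vpair x y.1) + 1 / δ * (g (vpair x y.1) - g (vpair x z.1)) ≤
        f (vpair x y.1) + 1 / δ * (g (vpair x y.1) - g (vpair x (zStar g A b x))) := by
      intro z
      have : g (vpair x (zStar g A b x)) ≤ g (vpair x z.1) := hz.ys_min x z.2
      gcongr
    exact le_antisymm (ciSup_le hle) (le_ciSup (f := fun z : feasibleSet A b =>
      f (vpair x y.1) + 1 / δ * (g (vpair x y.1) - g (vpair x z.1)))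
      ⟨_, Set.forall_mem_range.2 hle⟩ ⟨zStar g A b x, hz.ys_mem x⟩)
  unfold penaltyObj
  simp only [hsup]
  have hle : ∀ y : feasibleSet A b, 1 / δ * valueGap f g A b δ x ≤
      1 / δ * (penalized f g δ (vpair x y.1) - g (vpair x (zStar g A b x))) := by
    intro y
    have : penalized f g δ (vpair x (yStar f g A b δ x)) ≤ penalized f g δ (vpair x y.1) :=
      hy.ys_min x y.2
    unfold valueGap
    gcongr
  exact le_antisymm (ciInf_le (f := fun y : feasibleSet A b =>
    1 / δ * (penalized f g δ (vpair x y.1) - g (vpair x (zStar g A b x))))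
    ⟨_, Set.forall_mem_range.2 hle⟩ ⟨yStar f g A b δ x, hy.ys_mem x⟩) (le_ciInf hle)

theorem Assumptions.isEpsStationary (h : Assumptions f g A b lf0 lf1 lg1 μg) (hμ : 0 < μg)
    (hδ : 0 < δ) (hδ' : 2 * (lf1 : ℝ) * δ ≤ μg) {ε : ℝ} {x : Vec dx}
    (hx : ‖valueGapGrad f g A b δ x‖ ≤ δ * ε) : IsEpsStationary ε (penaltyObj f g A b δ) x := by
  have hq := (h.quad_valueGap hμ hδ.le hδ' rfl).const_mul (one_div_pos.2 hδ).le
  rw [h.penaltyObj_eq hμ hδ hδ']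
  refine ⟨fun y => (hq.hasGradientAt y).differentiableAt, ?_⟩
  rw [(hq.hasGradientAt x).gradient, norm_smul, Real.norm_eq_abs, abs_of_pos (one_div_pos.2 hδ),
    one_div, inv_mul_le_iff₀ hδ]
  exact hx

theorem Assumptions.sub_le_of_feasible (h : Assumptions f g A b lf0 lf1 lg1 μg) (x x' : Vec dx)
    {y y' : Vec dy} (hy : y ∈ feasibleSet A b) (hy' : y' ∈ feasibleSet A b) :
    f (vpair x y) - f (vpair x' y') ≤ lf0 * ‖vpair x y - vpair x' y'‖ := by
  have := h.lipschitz_f.dist_le_mul (vpair x y) hy (vpair x' y') hy'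
  rw [Real.dist_eq, dist_eq_norm] at this
  exact (le_abs_self _).trans this

/-- The two lower-level solutions differ by `O(δ)`. -/
theorem Assumptions.norm_yStar_sub_zStar_le (h : Assumptions f g A b lf0 lf1 lg1 μg)
    (hμ : 0 < μg) (hδ : 0 < δ) (hδ' : 2 * (lf1 : ℝ) * δ ≤ μg) (x : Vec dx) :
    ‖yStar f g A b δ x - zStar g A b x‖ ≤ 4 * lf0 / μg * δ := by
  have hy := h.solutions_y hμ hδ.le hδ' one_pos 1
  have hz := h.solutions_z hμ δ 1 one_pos
  -- Moving from `z*` to `y*_δ` costs `g` at least `μg/4` times the squared distance and gains at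
  -- most `δ lf0` times the distance.
  have h1 := (hz.model.strong x).growth (convex_feasibleSet A b) (hz.ys_mem x) (hz.ys_min x)
    (hy.ys_mem x)
  have h2 : penalized f g δ (vpair x (yStar f g A b δ x)) ≤
      penalized f g δ (vpair x (zStar g A b x)) := hy.ys_min x (hz.ys_mem x)
  have h3 := h.sub_le_of_feasible x x (hz.ys_mem x) (hy.ys_mem x)
  rw [norm_vpair_sub_right, norm_sub_rev] at h3
  unfold penalized at h2
  rw [div_mul_eq_mul_div, le_div_iff₀ hμ]
  by_contra! hlt
  have h4 : 0 < ‖yStar f g A b δ x - zStar g A b x‖ := by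
    by_contra! h0
    have : ‖yStar f g A b δ x - zStar g A b x‖ = 0 := le_antisymm h0 (norm_nonneg _)
    rw [this, zero_mul] at hlt
    exact absurd hlt (not_lt.2 (by positivity))
  have h5 := mul_le_mul_of_nonneg_left h3 hδ.le
  nlinarith

/-- Although `f` is Lipschitz only over feasible `y`, moving `x` alone along `v` stays in that
region. -/
theorem Assumptions.norm_grad_f_fst_le (h : Assumptions f g A b lf0 lf1 lg1 μg) (x : Vec dx)
    {y : Vec dy} (hy : y ∈ feasibleSet A b) : ‖(gradient f (vpair x y)).fst‖ ≤ lf0 := by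
  set v := (gradient f (vpair x y)).fst with hv
  by_contra! hlt
  have hpos : 0 < ‖v‖ := lt_of_le_of_lt lf0.2 hlt
  have : 0 ≤ lf0 * ‖v‖ - ‖v‖ ^ 2 := by
    apply nonneg_of_forall_add_mul_nonneg (c := lf1 / 2 * ‖v‖ ^ 2)
    intro t ht _
    have h1 := (h.quad_f.partial_left y).lower x (x + t • v)
    have h2 := h.sub_le_of_feasible (x + t • v) x hy hy
    rw [norm_vpair_sub_left] at h2
    rw [add_sub_cancel_left, norm_smul, Real.norm_eq_abs, abs_of_pos ht] at h1 h2
    rw [real_inner_smul_right, ← hv, real_inner_self_eq_norm_sq] at h1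
    refine nonneg_of_mul_nonneg_right (?_ : 0 ≤ t * _) ht
    linarith
  nlinarith

/-- The `g`-gradients nearly cancel because the two solutions are `O(δ)` apart. Thus `∇Φ_δ` is
bounded uniformly in `δ`, and only bounded `ε`, hence bounded `δ`, matter. -/
theorem Assumptions.norm_valueGapGrad_le (h : Assumptions f g A b lf0 lf1 lg1 μg)
    (hμ : 0 < μg) (hδ : 0 < δ) (hδ' : 2 * (lf1 : ℝ) * δ ≤ μg) (x : Vec dx) :
    ‖valueGapGrad f g A b δ x‖ ≤ δ * (lf0 + (lg1 + μg / 2) * (4 * lf0 / μg)) := by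
  have hy := h.solutions_y hμ hδ.le hδ' one_pos 1
  have h1 := h.norm_grad_f_fst_le x (hy.ys_mem x)
  have h2 := h.norm_yStar_sub_zStar_le hμ hδ hδ' x
  have h3 := (h.smoothModel hμ).smoothFamily.lip_left x (yStar f g A b δ x) (zStar g A b x)
  have e : valueGapGrad f g A b δ x = δ • (gradient f (vpair x (yStar f g A b δ x))).fst
      + ((gradient g (vpair x (yStar f g A b δ x))).fst
        - (gradient g (vpair x (zStar g A b x))).fst) := by
    simp only [valueGapGrad, penalizedGrad, WithLp.add_fst, WithLp.smul_fst]
    abel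
  rw [e]
  refine (norm_add_le _ _).trans ?_
  rw [norm_smul, Real.norm_eq_abs, abs_of_pos hδ]
  have h4 := mul_le_mul_of_nonneg_left h1 hδ.le
  have h5 := mul_le_mul_of_nonneg_left h2 (by positivity : 0 ≤ (lg1 : ℝ) + μg / 2)
  linarith

theorem Assumptions.valueGap_le (h : Assumptions f g A b lf0 lf1 lg1 μg) (hμ : 0 < μg)
    (hδ : 0 < δ) (hδ' : 2 * (lf1 : ℝ) * δ ≤ μg) (x : Vec dx) :
    valueGap f g A b δ x ≤ δ * hyperObj f g A b x := by
  have hy := h.solutions_y hμ hδ.le hδ' one_pos 1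
  have hz := h.solutions_z hμ δ 1 one_pos
  have h2 : penalized f g δ (vpair x (yStar f g A b δ x)) ≤
      penalized f g δ (vpair x (zStar g A b x)) := hy.ys_min x (hz.ys_mem x)
  unfold valueGap hyperObj
  unfold penalized at h2 ⊢
  linarith

theorem Assumptions.le_valueGap (h : Assumptions f g A b lf0 lf1 lg1 μg) (hμ : 0 < μg)
    (hδ : 0 < δ) (hδ' : 2 * (lf1 : ℝ) * δ ≤ μg) (x : Vec dx) :
    δ * hyperObj f g A b x - 4 * lf0 ^ 2 / μg * δ ^ 2 ≤ valueGap f g A b δ x := by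
  have hy := h.solutions_y hμ hδ.le hδ' one_pos 1
  have hz := h.solutions_z hμ δ 1 one_pos
  have h1 : g (vpair x (zStar g A b x)) ≤ g (vpair x (yStar f g A b δ x)) :=
    hz.ys_min x (hy.ys_mem x)
  have h2 := h.norm_yStar_sub_zStar_le hμ hδ hδ' x
  have h3 := h.sub_le_of_feasible x x (hz.ys_mem x) (hy.ys_mem x)
  rw [norm_vpair_sub_right, norm_sub_rev] at h3
  have h4 : (lf0 : ℝ) * ‖yStar f g A b δ x - zStar g A b x‖ ≤ lf0 * (4 * lf0 / μg * δ) := by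
    gcongr
  have h5 := mul_le_mul_of_nonneg_left (h3.trans h4) hδ.le
  have e : 4 * (lf0 : ℝ) ^ 2 / μg * δ ^ 2 = δ * (lf0 * (4 * lf0 / μg * δ)) := by ring
  rw [e]
  unfold valueGap hyperObj penalized
  linarith

/-! ### The algorithm -/

/-- Ascent on `K` in `z'` is descent on the Lagrangian of `g`, so both blocks take the form required
by `exists_merit_decrease`. -/
theorem sflcbStep_eq (h : Assumptions f g A b lf0 lf1 lg1 μg) (hμ : 0 < μg)
    (hδ : 0 ≤ δ) (hδ' : 2 * (lf1 : ℝ) * δ ≤ μg) (hρ₁ : 0 < ρ₁) (hρ₂ : 0 < ρ₂) (η : StepSizes)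
    (s : State dx dy dh) :
    sflcbStep f g A b δ ρ₁ ρ₂ η s =
      { x := s.x - η.ηx • ((penalizedGrad f g δ (vpair s.x s.y'.fst)).fst
          - (gradient g (vpair s.x s.z'.fst)).fst)
        y' := projSlack (s.y' - η.ηy • lagGrad (penalizedGrad f g δ) A b ρ₁
          (s.u + η.ηu • residual A b s.y') s.x s.y')
        z' := projSlack (s.z' - η.ηz • lagGrad (gradient g) A b ρ₂
          (s.v + η.ηv • residual A b s.z') s.x s.z')
        u := s.u + η.ηu • residual A b s.y'
        v := s.v + η.ηv • residual A b s.z' } := by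
  have hy := h.smoothModel_penalized hδ hδ'
  have hz := h.smoothModel hμ
  have hμ2 : 0 < μg / 2 := by positivity
  have hL : 0 ≤ (lg1 : ℝ) + μg / 2 := by positivity
  have ex : ∀ u₁ v₁ : Vec dh, gradient (fun x => augLag f g A b δ ρ₁ ρ₂ x s.y' s.z' u₁ v₁) s.x =
      (penalizedGrad f g δ (vpair s.x s.y'.fst)).fst - (gradient g (vpair s.x s.z'.fst)).fst := by
    intro u₁ v₁
    simp only [augLag_eq]
    exact ((((hy.lag_smoothFamily (A := A) hμ2 hL hρ₁ b u₁).quad_left s.y').sub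
      ((hz.lag_smoothFamily (A := A) hμ2 hL hρ₂ b v₁).quad_left s.z')).hasGradientAt s.x).gradient
  have ey : ∀ u₁ v₁ : Vec dh, gradient (fun y' => augLag f g A b δ ρ₁ ρ₂ s.x y' s.z' u₁ v₁) s.y' =
      lagGrad (penalizedGrad f g δ) A b ρ₁ u₁ s.x s.y' := by
    intro u₁ v₁
    simp only [augLag_eq, sub_eq_add_neg]
    exact (((hy.lag_quadBounds (A := A) hμ2 hL hρ₁ b u₁ s.x).add_const _).hasGradientAt
      s.y').gradient
  have ez : ∀ u₁ v₁ : Vec dh, gradient (fun z' => augLag f g A b δ ρ₁ ρ₂ s.x s.y' z' u₁ v₁) s.z' =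
      -lagGrad (gradient g) A b ρ₂ v₁ s.x s.z' := by
    intro u₁ v₁
    simp only [augLag_eq, sub_eq_neg_add]
    exact (((hz.lag_quadBounds (A := A) hμ2 hL hρ₂ b v₁ s.x).neg.add_const _).hasGradientAt
      s.z').gradient
  unfold sflcbStep
  simp only [ex, ey, ez, smul_neg, ← sub_eq_add_neg]

/-- Step sizes for which the potential decreases along the algorithm. -/
theorem exists_stepSizes (A : Matrix (Fin dh) (Fin dy) ℝ) {μg : ℝ} (hμ : 0 < μg) (lg1 : ℝ≥0)
    (hρ₁ : 0 < ρ₁) (hρ₂ : 0 < ρ₂) :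
    ∃ η : StepSizes, η.Positive ∧ ∀ (dx : ℕ) (b : Vec dh) (f g : VecPair dx dy → ℝ)
      (lf0 lf1 : ℝ≥0), Assumptions f g A b lf0 lf1 lg1 μg → ∀ δ : ℝ, 0 < δ →
      2 * (lf1 : ℝ) * δ ≤ μg → ∀ s : State dx dy dh, s.Admissible →
      (sflcbStep f g A b δ ρ₁ ρ₂ η s).Admissible ∧
      potential f g A b δ ρ₁ ρ₂ (sflcbStep f g A b δ ρ₁ ρ₂ η s) ≤
        potential f g A b δ ρ₁ ρ₂ s - η.ηx / 2 * ‖valueGapGrad f g A b δ s.x‖ ^ 2 := by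
  set L : ℝ := lg1 + μg / 2 with hL_def
  have hμ2 : 0 < μg / 2 := by positivity
  have hL : 0 < L := by positivity
  obtain ⟨ηy, ηu, κy, Cy, hηy, hηu, hκy, hCy, Hy⟩ := exists_merit_decrease A hμ2 hL hρ₁
  obtain ⟨ηz, ηv, κz, Cz, hηz, hηv, hκz, hCz, Hz⟩ := exists_merit_decrease A hμ2 hL hρ₂
  set C : ℝ := Cy + Cz + (L + (L + 2 * L ^ 2 / (μg / 2))) / 2 with hC_def
  have hC : 0 < C := by positivity
  -- The first two bounds let `κy` and `κz` pay for the error of the direction `D`; the last absorbs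
  -- all terms quadratic in the displacement of `x`.
  set ηx : ℝ := min (min (κy / L ^ 2) (κz / L ^ 2)) (1 / (2 * C)) with hηx_def
  have hηx : 0 < ηx := by positivity
  have hx1 : ηx * L ^ 2 ≤ κy := by
    rw [← le_div_iff₀ (by positivity)]
    exact (min_le_left _ _).trans (min_le_left _ _)
  have hx2 : ηx * L ^ 2 ≤ κz := by
    rw [← le_div_iff₀ (by positivity)]
    exact (min_le_left _ _).trans (min_le_right _ _)
  have hx3 : ηx * (2 * C) ≤ 1 := by
    rw [← le_div_iff₀ (by positivity)]
    exact min_le_right _ _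
  refine ⟨⟨ηx, ηy, ηz, ηu, ηv⟩, ⟨hηx, hηy, hηz, hηu, hηv⟩, ?_⟩
  intro dx b f g lf0 lf1 h δ hδ hδ' s hs
  rw [sflcbStep_eq h hμ hδ.le hδ' hρ₁ hρ₂]
  refine ⟨⟨projSlack_mem _, projSlack_mem _⟩, ?_⟩
  have Sy := h.solutions_y hμ hδ.le hδ' hρ₁ ρ₂
  have Sz := h.solutions_z hμ δ ρ₁ hρ₂
  set D := (penalizedGrad f g δ (vpair s.x s.y'.fst)).fst - (gradient g (vpair s.x s.z'.fst)).fst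
    with hD_def
  have h1 := Hy dx b _ _ _ _ Sy s.x (s.x - ηx • D) s.y' _ s.u _ hs.1 rfl rfl
  have h2 := Hz dx b _ _ _ _ Sz s.x (s.x - ηx • D) s.z' _ s.v _ hs.2 rfl rfl
  have h3 := (h.quad_valueGap hμ hδ.le hδ' hL_def).upper s.x (s.x - ηx • D)
  have e1 : s.x - ηx • D - s.x = -(ηx • D) := by abel
  rw [e1, norm_neg, norm_smul, Real.norm_eq_abs, abs_of_pos hηx] at h1 h2 h3
  rw [inner_neg_right, real_inner_smul_right] at h3
  -- The inner product in `h3` is polarized: `-ηx ⟪∇, D⟫ = ηx/2 (‖D - ∇‖² - ‖D‖² - ‖∇‖²)`.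
  have h4 : ‖D - valueGapGrad f g A b δ s.x‖ ^ 2 ≤
      2 * L ^ 2 * ‖s.y'.fst - yStar f g A b δ s.x‖ ^ 2
      + 2 * L ^ 2 * ‖s.z'.fst - zStar g A b s.x‖ ^ 2 := by
    have k1 := Sy.model.smoothFamily.lip_left s.x s.y'.fst (yStar f g A b δ s.x)
    have k2 := Sz.model.smoothFamily.lip_left s.x s.z'.fst (zStar g A b s.x)
    have e2 : D - valueGapGrad f g A b δ s.x =
        ((penalizedGrad f g δ (vpair s.x s.y'.fst)).fst
          - (penalizedGrad f g δ (vpair s.x (yStar f g A b δ s.x))).fst)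
        - ((gradient g (vpair s.x s.z'.fst)).fst
          - (gradient g (vpair s.x (zStar g A b s.x))).fst) := by
      rw [hD_def, valueGapGrad]
      abel
    have k3 := (norm_sub_le _ _).trans (add_le_add k1 k2)
    rw [← e2] at k3
    refine (pow_le_pow_left₀ (norm_nonneg _) k3 2).trans ?_
    rw [← sub_nonneg]
    refine (sq_nonneg (L * ‖s.y'.fst - yStar f g A b δ s.x‖
      - L * ‖s.z'.fst - zStar g A b s.x‖)).trans (le_of_eq ?_)
    ring
  rw [norm_sub_sq_real, real_inner_comm] at h4
  have h5 := mul_le_mul_of_nonneg_left h4 hηx.le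
  have h6 := mul_le_mul_of_nonneg_right hx1 (sq_nonneg ‖s.y'.fst - yStar f g A b δ s.x‖)
  have h7 := mul_le_mul_of_nonneg_right hx2 (sq_nonneg ‖s.z'.fst - zStar g A b s.x‖)
  have h8 : C * (ηx * ‖D‖) ^ 2 ≤ ηx / 2 * ‖D‖ ^ 2 := by
    have := mul_le_mul_of_nonneg_right hx3 (by positivity : 0 ≤ ηx / 2 * ‖D‖ ^ 2)
    linarith
  have h9 : C * (ηx * ‖D‖) ^ 2 = Cy * (ηx * ‖D‖) ^ 2 + Cz * (ηx * ‖D‖) ^ 2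
      + (L + (L + 2 * L ^ 2 / (μg / 2))) / 2 * (ηx * ‖D‖) ^ 2 := by
    rw [hC_def]
    ring
  unfold potential
  dsimp only
  linarith

theorem Assumptions.le_potential (h : Assumptions f g A b lf0 lf1 lg1 μg) (hμ : 0 < μg)
    (hδ : 0 < δ) (hδ' : 2 * (lf1 : ℝ) * δ ≤ μg) (hρ₁ : 0 < ρ₁) (hρ₂ : 0 < ρ₂)
    {s : State dx dy dh} (hs : s.Admissible) :
    δ * hyperObj f g A b s.x - 4 * lf0 ^ 2 / μg * δ ^ 2 ≤ potential f g A b δ ρ₁ ρ₂ s := by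
  have h1 := (h.solutions_y hμ hδ.le hδ' hρ₁ ρ₂).merit_nonneg s.x hs.1 s.u
  have h2 := (h.solutions_z hμ δ ρ₁ hρ₂).merit_nonneg s.x hs.2 s.v
  have h3 := h.le_valueGap hμ hδ hδ' s.x
  unfold potential
  linarith

theorem exists_le_of_sum_decrease {V a : ℕ → ℝ} {c m τ R : ℝ} (hc : 0 < c) (hτ : 0 < τ)
    (hR : 0 ≤ R) (hdec : ∀ t, V (t + 1) ≤ V t - c * a t) (hm : ∀ t, m ≤ V t)
    (h0 : V 0 - m ≤ c * τ * R) : ∃ t : ℕ, (t : ℝ) ≤ R ∧ a t ≤ τ := by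
  by_contra! hcon
  -- Telescoping over `⌊R⌋ + 1` steps, strictly more than `R`, contradicts the strict decrease
  -- needed; the last index tested is `⌊R⌋`.
  have h1 : ∀ N : ℕ, N ≤ ⌊R⌋₊ + 1 → V N ≤ V 0 - c * τ * N := by
    intro N
    induction N with
    | zero => simp
    | succ N ih =>
      intro hN
      have h2 := ih (by omega)
      have h3 := hcon N ((Nat.le_floor_iff hR).1 (by omega))
      have h4 := hdec N
      have h5 := mul_le_mul_of_nonneg_left h3.le hc.le
      push_cast
      linarith
  have h2 := h1 _ le_rfl
  have h3 := hm (⌊R⌋₊ + 1)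
  have h4 := mul_lt_mul_of_pos_left (Nat.lt_floor_add_one R) (mul_pos hc hτ)
  push_cast at h2
  linarith

/-- The iteration bound from a bound on the initial potential. -/
theorem exists_stationary_iterate (h : Assumptions f g A b lf0 lf1 lg1 μg) (hμ : 0 < μg)
    (hρ₁ : 0 < ρ₁) (hρ₂ : 0 < ρ₂) (hδ : 0 < δ) (hδ' : 2 * (lf1 : ℝ) * δ ≤ μg) {η : StepSizes}
    (hη : 0 < η.ηx)
    (hdec : ∀ s : State dx dy dh, s.Admissible → (sflcbStep f g A b δ ρ₁ ρ₂ η s).Admissible ∧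
      potential f g A b δ ρ₁ ρ₂ (sflcbStep f g A b δ ρ₁ ρ₂ η s) ≤
        potential f g A b δ ρ₁ ρ₂ s - η.ηx / 2 * ‖valueGapGrad f g A b δ s.x‖ ^ 2)
    {s₀ : State dx dy dh} (hs₀ : s₀.Admissible) {ε F R : ℝ} (hε : 0 < ε) (hR : 0 ≤ R)
    (hF : ∀ x, F ≤ hyperObj f g A b x)
    (hbound : potential f g A b δ ρ₁ ρ₂ s₀ - (δ * F - 4 * lf0 ^ 2 / μg * δ ^ 2) ≤
      η.ηx / 2 * (δ * ε) ^ 2 * R) :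
    ∃ t : ℕ, (t : ℝ) ≤ R ∧
      IsEpsStationary ε (penaltyObj f g A b δ) (sflcb f g A b δ ρ₁ ρ₂ η s₀ t).x := by
  have hsucc : ∀ t, sflcb f g A b δ ρ₁ ρ₂ η s₀ (t + 1) =
      sflcbStep f g A b δ ρ₁ ρ₂ η (sflcb f g A b δ ρ₁ ρ₂ η s₀ t) := by
    intro t
    simp only [sflcb, Function.iterate_succ_apply']
  have hadm : ∀ t, (sflcb f g A b δ ρ₁ ρ₂ η s₀ t).Admissible := by
    intro t
    induction t with
    | zero => exact hs₀
    | succ t ih =>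
      rw [hsucc]
      exact (hdec _ ih).1
  obtain ⟨t, ht, hle⟩ := exists_le_of_sum_decrease
    (V := fun t => potential f g A b δ ρ₁ ρ₂ (sflcb f g A b δ ρ₁ ρ₂ η s₀ t))
    (a := fun t => ‖valueGapGrad f g A b δ (sflcb f g A b δ ρ₁ ρ₂ η s₀ t).x‖ ^ 2)
    (half_pos hη) (by positivity : 0 < (δ * ε) ^ 2) hR
    (fun t => by
      rw [hsucc]
      exact (hdec _ (hadm t)).2)
    (fun t => by
      have h1 := h.le_potential hμ hδ hδ' hρ₁ hρ₂ (hadm t)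
      have h2 := mul_le_mul_of_nonneg_left (hF (sflcb f g A b δ ρ₁ ρ₂ η s₀ t).x) hδ.le
      linarith) hbound
  refine ⟨t, ht, h.isEpsStationary hμ hδ hδ' ?_⟩
  exact le_of_sq_le_sq hle (by positivity)

/-- The merit function of a fixed point is bounded uniformly in bounded `δ`. -/
theorem Assumptions.exists_merit_bound (h : Assumptions f g A b lf0 lf1 lg1 μg) (hμ : 0 < μg)
    (hρ₁ : 0 < ρ₁) (ρ₂ : ℝ) (x : Vec dx) (p : VecPair dy dh) (u : Vec dh) (δmax : ℝ) :
    ∃ B : ℝ, ∀ δ, 0 < δ → δ ≤ δmax → 2 * (lf1 : ℝ) * δ ≤ μg →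
      merit (penalized f g δ) A b ρ₁ (yAugStar f g A b δ ρ₁ ρ₂) (yStar f g A b δ) x p u ≤ B := by
  obtain ⟨y, hy⟩ := h.feasible_nonempty
  -- The bound of `merit_le` involves no minimizer, so it is continuous in `δ` and bounded on `[0,
  -- δmax]`.
  have hcont : Continuous fun δ : ℝ =>
      penalized f g δ (vpair x y) - lag (penalized f g δ) A b ρ₁ u x p
      + ‖lagGrad (penalizedGrad f g δ) A b ρ₁ u x p‖ ^ 2 / lagModulus A (μg / 2) ρ₁ := by
    have e : ∀ δ : ℝ, ‖lagGrad (penalizedGrad f g δ) A b ρ₁ u x p‖ ^ 2 =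
        ‖δ • (gradient f (vpair x p.fst)).snd + (gradient g (vpair x p.fst)).snd
          + LinearMap.adjoint (Matrix.toEuclideanLin A) (u + ρ₁ • residual A b p)‖ ^ 2
        + ‖-(u + ρ₁ • residual A b p)‖ ^ 2 := by
      intro δ
      rw [WithLp.prod_norm_sq_eq_of_L2]
      rfl
    simp only [e, penalized, lag]
    fun_prop
  obtain ⟨B, hB⟩ := (isCompact_Icc (a := (0 : ℝ)) (b := δmax)).exists_bound_of_continuousOn
    hcont.continuousOn
  refine ⟨B, fun δ hδ hδm hδ' => ?_⟩
  exact ((h.solutions_y hμ hδ.le hδ' hρ₁ ρ₂).merit_le (by positivity) (by positivity) hρ₁ x p u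
    hy).trans ((le_abs_self _).trans (hB δ ⟨hδ.le, hδm⟩))

end Bilevel

/-! ### Initial potential and iteration count -/

section Complexity

variable {dx dy dh : ℕ} {A : Matrix (Fin dh) (Fin dy) ℝ} {b : Vec dh} {f g : VecPair dx dy → ℝ}
  {lf0 lf1 lg1 : ℝ≥0} {μg ρ₁ ρ₂ : ℝ}

/-- For large `ε` every point is `ε`-stationary. -/
theorem Assumptions.isEpsStationary_of_large (h : Assumptions f g A b lf0 lf1 lg1 μg)
    (hμ : 0 < μg) {δ : ℝ} (hδ : 0 < δ) (hδ' : 2 * (lf1 : ℝ) * δ ≤ μg) {ε : ℝ}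
    (hε : lf0 + (lg1 + μg / 2) * (4 * lf0 / μg) ≤ ε) (x : Vec dx) :
    IsEpsStationary ε (penaltyObj f g A b δ) x :=
  h.isEpsStationary hμ hδ hδ'
    ((h.norm_valueGapGrad_le hμ hδ hδ' x).trans (mul_le_mul_of_nonneg_left hε hδ.le))

/-- The initial potential is bounded uniformly in bounded `δ`. -/
theorem Assumptions.exists_potential_bound (h : Assumptions f g A b lf0 lf1 lg1 μg) (hμ : 0 < μg)
    (hρ₁ : 0 < ρ₁) (hρ₂ : 0 < ρ₂) (s : State dx dy dh) {F : ℝ} (hF : F ≤ hyperObj f g A b s.x)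
    (K δmax : ℝ) (hK : 0 ≤ K) :
    ∃ B : ℝ, 0 ≤ B ∧ ∀ δ, 0 < δ → δ ≤ δmax → 2 * (lf1 : ℝ) * δ ≤ μg →
      potential f g A b δ ρ₁ ρ₂ s - (δ * F - K * δ ^ 2) ≤ B := by
  obtain ⟨B₁, hB₁⟩ := h.exists_merit_bound hμ hρ₁ ρ₂ s.x s.y' s.u δmax
  obtain ⟨y, hy⟩ := h.feasible_nonempty
  set B₂ := g (vpair s.x y) - lag g A b ρ₂ s.v s.x s.z'
    + ‖lagGrad (gradient g) A b ρ₂ s.v s.x s.z'‖ ^ 2 / lagModulus A (μg / 2) ρ₂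
  have hΔ : 0 ≤ hyperObj f g A b s.x - F := sub_nonneg.2 hF
  refine ⟨|B₁| + |B₂| + |δmax| * (hyperObj f g A b s.x - F) + K * |δmax| ^ 2, by positivity,
    fun δ hδ hδm hδ' => ?_⟩
  have h1 := (hB₁ δ hδ hδm hδ').trans (le_abs_self B₁)
  have h2 := ((h.solutions_z hμ δ ρ₁ hρ₂).merit_le (by positivity) (by positivity) hρ₂ s.x s.z' s.v
    hy).trans (le_abs_self B₂)
  have h3 := h.valueGap_le hμ hδ hδ' s.x
  have hδa : δ ≤ |δmax| := hδm.trans (le_abs_self _)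
  have h4 := mul_le_mul_of_nonneg_right hδa hΔ
  have h5 : K * δ ^ 2 ≤ K * |δmax| ^ 2 := by gcongr
  unfold potential
  linarith

/-- The initial potential is `O(δ)` for an `O(δ)`-close initial point. -/
theorem exists_potential_bound_of_close (h : Assumptions f g A b lf0 lf1 lg1 μg) (hμ : 0 < μg)
    (hρ₁ : 0 < ρ₁) (hρ₂ : 0 < ρ₂) (x₀ : Vec dx) {F : ℝ} (hF : F ≤ hyperObj f g A b x₀)
    {K δmax : ℝ} (hK : 0 ≤ K) (hδmax : 0 ≤ δmax) (κ : ℝ) :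
    ∃ B : ℝ, 0 ≤ B ∧ ∀ δ, 0 < δ → δ ≤ δmax → 2 * (lf1 : ℝ) * δ ≤ μg →
      ∀ s : State dx dy dh, s.x = x₀ → InitClose f g A b δ ρ₁ ρ₂ (κ * δ) s →
      potential f g A b δ ρ₁ ρ₂ s - (δ * F - K * δ ^ 2) ≤ δ * (B * (1 + ‖s.u‖ + ‖s.v‖)) := by
  set L : ℝ := lg1 + μg / 2 with hL_def
  have hμ2 : 0 < μg / 2 := by positivity
  have hL : 0 < L := by positivity
  obtain ⟨σ, hσ0, hσ⟩ := exists_error_bound A hμ2 hL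
  -- Bounds the lower-level gradients at both solutions uniformly in `δ`, by comparison with
  -- `zStar`, which does not depend on `δ`.
  set N : ℝ := δmax * ‖(gradient f (vpair x₀ (zStar g A b x₀))).snd‖
    + ‖(gradient g (vpair x₀ (zStar g A b x₀))).snd‖ + L * (4 * lf0 / μg * δmax) with hN_def
  have hN0 : 0 ≤ N := by positivity
  have hΔ : 0 ≤ hyperObj f g A b x₀ - F := sub_nonneg.2 hF
  set Q : ℝ → ℝ := fun ρ => |κ| * (N + 2 * (N * σ) + 3 + (L + ρ) / 2 * (|κ| * δmax)) with hQ_def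
  have hQ0 : ∀ ρ, 0 < ρ → 0 ≤ Q ρ := fun ρ hρ => by
    simp only [hQ_def]
    positivity
  have hQ : ∀ ρ δ w, 0 < ρ → 0 < δ → δ ≤ δmax → 0 ≤ w →
      |κ| * δ * (N + 2 * (N * σ) + 3 * w + (L + ρ) / 2 * (|κ| * δ)) ≤ δ * (Q ρ * (1 + w)) := by
    intro ρ δ w hρ hδ hδm hw
    have h1 : N + 2 * (N * σ) + 3 * w + (L + ρ) / 2 * (|κ| * δ) ≤
        (N + 2 * (N * σ) + 3 + (L + ρ) / 2 * (|κ| * δmax)) * (1 + w) := by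
      have h2 : (L + ρ) / 2 * (|κ| * δ) ≤ (L + ρ) / 2 * (|κ| * δmax) := by gcongr
      have h3 : 0 ≤ (N + 2 * (N * σ) + (L + ρ) / 2 * (|κ| * δmax)) * w := by positivity
      linarith
    have h2 := mul_le_mul_of_nonneg_left h1 (by positivity : 0 ≤ |κ| * δ)
    simp only [hQ_def]
    linarith
  have hQ₁ := hQ0 ρ₁ hρ₁
  have hQ₂ := hQ0 ρ₂ hρ₂
  refine ⟨Q ρ₁ + Q ρ₂ + (hyperObj f g A b x₀ - F) + K * δmax, by positivity,
    fun δ hδ hδm hδ' s hsx hs => ?_⟩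
  subst hsx
  have Sy := h.solutions_y hμ hδ.le hδ' hρ₁ ρ₂
  have Sz := h.solutions_z hμ δ ρ₁ hρ₂
  have hr : κ * δ ≤ |κ| * δ := mul_le_mul_of_nonneg_right (le_abs_self κ) hδ.le
  have hNz : ‖(gradient g (vpair s.x (zStar g A b s.x))).snd‖ ≤ N := by
    have h1 : 0 ≤ δmax * ‖(gradient f (vpair s.x (zStar g A b s.x))).snd‖ := by positivity
    have h2 : 0 ≤ L * (4 * lf0 / μg * δmax) := by positivity
    linarith
  have hNy : ‖(penalizedGrad f g δ (vpair s.x (yStar f g A b δ s.x))).snd‖ ≤ N := by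
    have h1 := (WithLp.norm_snd_le _ _).trans
      (Sy.model.lip (vpair s.x (yStar f g A b δ s.x)) (vpair s.x (zStar g A b s.x)))
    rw [norm_vpair_sub_right, WithLp.sub_snd, ← hL_def] at h1
    have h2 := norm_le_norm_add_norm_sub'
      (penalizedGrad f g δ (vpair s.x (yStar f g A b δ s.x))).snd
      (penalizedGrad f g δ (vpair s.x (zStar g A b s.x))).snd
    have h3 : ‖(penalizedGrad f g δ (vpair s.x (zStar g A b s.x))).snd‖ ≤
        δmax * ‖(gradient f (vpair s.x (zStar g A b s.x))).snd‖
        + ‖(gradient g (vpair s.x (zStar g A b s.x))).snd‖ := by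
      simp only [penalizedGrad, WithLp.add_snd, WithLp.smul_snd]
      refine (norm_add_le _ _).trans ?_
      rw [norm_smul, Real.norm_eq_abs, abs_of_pos hδ]
      gcongr
    have h4 : L * ‖yStar f g A b δ s.x - zStar g A b s.x‖ ≤ L * (4 * lf0 / μg * δmax) := by
      gcongr
      exact (h.norm_yStar_sub_zStar_le hμ hδ hδ' s.x).trans (by gcongr)
    linarith
  have h1 := (Sy.merit_le_of_close hμ2 hL.le hρ₁ s.x s.y' s.u (hσ _ _ _ _ _ _ _ Sy s.x s.u) hσ0.le
    hNy (hs.y_close.trans hr) (hs.yAug_residual.trans hr) (hs.y_residual.trans hr)).trans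
    (hQ ρ₁ δ ‖s.u‖ hρ₁ hδ hδm (norm_nonneg _))
  have h2 := (Sz.merit_le_of_close hμ2 hL.le hρ₂ s.x s.z' s.v (hσ _ _ _ _ _ _ _ Sz s.x s.v) hσ0.le
    hNz (hs.z_close.trans hr) (hs.zAug_residual.trans hr) (hs.z_residual.trans hr)).trans
    (hQ ρ₂ δ ‖s.v‖ hρ₂ hδ hδm (norm_nonneg _))
  have h3 := h.valueGap_le hμ hδ hδ' s.x
  have h4 : K * δ ^ 2 ≤ δ * (K * δmax) := by
    have := mul_le_mul_of_nonneg_left hδm (by positivity : 0 ≤ K * δ)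
    linarith
  have hu := norm_nonneg s.u
  have hv := norm_nonneg s.v
  have h5 : Q ρ₁ * (1 + ‖s.u‖) + Q ρ₂ * (1 + ‖s.v‖) + (hyperObj f g A b s.x - F) + K * δmax ≤
      (Q ρ₁ + Q ρ₂ + (hyperObj f g A b s.x - F) + K * δmax) * (1 + ‖s.u‖ + ‖s.v‖) := by
    have k1 : 0 ≤ Q ρ₁ * ‖s.v‖ := by positivity
    have k2 : 0 ≤ Q ρ₂ * ‖s.u‖ := by positivity
    have k3 : 0 ≤ ((hyperObj f g A b s.x - F) + K * δmax) * (‖s.u‖ + ‖s.v‖) := by positivity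
    linarith
  have h6 := mul_le_mul_of_nonneg_left h5 hδ.le
  unfold potential
  linarith

end Complexity

end

end SFLCB

theorem mainTheorem4 (dx dy dh : ℕ) (A : Matrix (Fin dh) (Fin dy) ℝ)
    (μg : ℝ) (hμg : 0 < μg) (lg1 : ℝ≥0) (ρ₁ ρ₂ : ℝ) (hρ₁ : 0 < ρ₁) (hρ₂ : 0 < ρ₂) :
    ∃ η : SFLCB.StepSizes, η.Positive ∧
      ∀ (b : Vec dh) (f g : VecPair dx dy → ℝ) (lf0 lf1 : ℝ≥0),
        SFLCB.Assumptions f g A b lf0 lf1 lg1 μg →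
        ∀ c₁ c₂ : ℝ, 0 < c₁ → c₁ ≤ c₂ →
          -- arbitrary initial point: `O(ε⁻⁴)` iterations
          (∀ s₀ : SFLCB.State dx dy dh, s₀.Admissible →
            ∃ C : ℝ, ∀ ε δ : ℝ, 0 < ε → c₁ * ε ≤ δ → δ ≤ c₂ * ε → 2 * (lf1 : ℝ) * δ ≤ μg →
              ∃ t : ℕ, (t : ℝ) ≤ C / ε ^ 4 ∧
                SFLCB.IsEpsStationary ε (SFLCB.penaltyObj f g A b δ)
                  (SFLCB.sflcb f g A b δ ρ₁ ρ₂ η s₀ t).x) ∧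
          -- `O(δ)`-close initial point, which may vary with `ε` and `δ`: `O(ε⁻³)` iterations
          (∀ (x₀ : Vec dx) (κ : ℝ), ∃ C : ℝ,
            ∀ ε δ : ℝ, 0 < ε → c₁ * ε ≤ δ → δ ≤ c₂ * ε → 2 * (lf1 : ℝ) * δ ≤ μg →
              ∀ s₀ : SFLCB.State dx dy dh, s₀.x = x₀ → s₀.Admissible →
                SFLCB.InitClose f g A b δ ρ₁ ρ₂ (κ * δ) s₀ →
                ∃ t : ℕ, (t : ℝ) ≤ C * (1 + ‖s₀.u‖ + ‖s₀.v‖) / ε ^ 3 ∧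
                  SFLCB.IsEpsStationary ε (SFLCB.penaltyObj f g A b δ)
                    (SFLCB.sflcb f g A b δ ρ₁ ρ₂ η s₀ t).x) := by
  obtain ⟨η, hη, H⟩ := SFLCB.exists_stepSizes (dy := dy) A hμg lg1 hρ₁ hρ₂
  refine ⟨η, hη, ?_⟩
  intro b f g lf0 lf1 h c₁ c₂ hc₁ hc₁₂
  have hηx : 0 < η.ηx := hη.1
  have hc₂ : 0 < c₂ := hc₁.trans_le hc₁₂
  obtain ⟨F, hF⟩ := h.hyperObj_bddBelow
  replace hF : ∀ x, F ≤ SFLCB.hyperObj f g A b x := fun x => hF ⟨x, rfl⟩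
  -- For `ε ≥ E` iterate `0` is already stationary; otherwise `δ ≤ c₂ E`.
  set E : ℝ := lf0 + (lg1 + μg / 2) * (4 * lf0 / μg)
  have hE : 0 ≤ E := by positivity
  have hK : 0 ≤ 4 * (lf0 : ℝ) ^ 2 / μg := by positivity
  constructor
  · intro s₀ hs₀
    obtain ⟨B, hB0, hB⟩ := h.exists_potential_bound hμg hρ₁ hρ₂ s₀ (hF s₀.x)
      (4 * (lf0 : ℝ) ^ 2 / μg) (c₂ * E) hK
    refine ⟨2 * B / (η.ηx * c₁ ^ 2), ?_⟩
    intro ε δ hε hδ₁ hδ₂ hδ'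
    have hδ : 0 < δ := (mul_pos hc₁ hε).trans_le hδ₁
    rcases le_total E ε with hEε | hεE
    · exact ⟨0, by simp only [Nat.cast_zero]; positivity,
        h.isEpsStationary_of_large hμg hδ hδ' hEε _⟩
    refine SFLCB.exists_stationary_iterate h hμg hρ₁ hρ₂ hδ hδ' hηx
      (H dx b f g lf0 lf1 h δ hδ hδ') hs₀ hε (by positivity) hF
      ((hB δ hδ (hδ₂.trans (by gcongr)) hδ').trans ?_)
    -- Both powers of `δ` in the per-step decrease are traded for `c₁ ε`, hence `ε⁻⁴`.
    have e : η.ηx / 2 * (δ * ε) ^ 2 * (2 * B / (η.ηx * c₁ ^ 2) / ε ^ 4) =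
        B * (δ / (c₁ * ε)) ^ 2 := by
      field_simp
    rw [e]
    have h1 : 1 ≤ δ / (c₁ * ε) := (one_le_div (by positivity)).2 hδ₁
    exact le_mul_of_one_le_right hB0 (one_le_pow₀ h1)
  · intro x₀ κ
    obtain ⟨B, hB0, hB⟩ := SFLCB.exists_potential_bound_of_close h hμg hρ₁ hρ₂ x₀ (hF x₀) hK
      (by positivity : 0 ≤ c₂ * E) κ
    refine ⟨2 * B / (η.ηx * c₁), ?_⟩
    intro ε δ hε hδ₁ hδ₂ hδ' s₀ hsx hs₀ hclose
    have hδ : 0 < δ := (mul_pos hc₁ hε).trans_le hδ₁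
    rcases le_total E ε with hEε | hεE
    · exact ⟨0, by simp only [Nat.cast_zero]; positivity,
        h.isEpsStationary_of_large hμg hδ hδ' hEε _⟩
    refine SFLCB.exists_stationary_iterate h hμg hρ₁ hρ₂ hδ hδ' hηx
      (H dx b f g lf0 lf1 h δ hδ hδ') hs₀ hε (by positivity) hF
      ((hB δ hδ (hδ₂.trans (by gcongr)) hδ' s₀ hsx hclose).trans ?_)
    -- One power of `δ` is matched by the `O(δ)` initial excess, so only one is traded for `c₁ ε`,
    -- hence `ε⁻³`.
    have e : η.ηx / 2 * (δ * ε) ^ 2 *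
        (2 * B / (η.ηx * c₁) * (1 + ‖s₀.u‖ + ‖s₀.v‖) / ε ^ 3) =
        δ * (B * (1 + ‖s₀.u‖ + ‖s₀.v‖)) * (δ / (c₁ * ε)) := by
      field_simp
    rw [e]
    have h1 : 1 ≤ δ / (c₁ * ε) := (one_le_div (by positivity)).2 hδ₁
    exact le_mul_of_one_le_right (by positivity) h1
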